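/- Let $\Bbbk$ be a field of characteristic zero and $H=\Bbbk[D]$, with $\Delta(D)=D\otimes 1+1\otimes D$. A conformal algebra is a unital left $H$-module $C$ with $\Bbbk$-bilinear products $(\cdot\,{}_{(n)}\,\cdot)$, $n\ge 0$, such that for all $a,b\in C$ one has $a\,{}_{(n)}\,b=0$ for all sufficiently large $n$, and $Da\,{}_{(n)}\,b=-n\,a\,{}_{(n-1)}\,b$, $a\,{}_{(n)}\,Db=D(a\,{}_{(n)}\,b)+n\,a\,{}_{(n-1)}\,b$ for $n\ge 0$. Its coefficient algebra $\mathrm{Coeff}\,C$ is the space $\Bbbk[t,t^{-1}]\otimes_H C$, where $t^nD=-nt^{n-1}$, with the bilinear multiplication determined by $a(n)b(m)=\sum_{s\ge 0}\binom{n}{s}(a\,{}_{(s)}\,b)(n+m-s)$, $n,m\in\mathbb Z$, where $a(n)=t^n\otimes_H a$. An algebra is anti-commutative if $xy=-yx$; an anti-commutative algebra is Mal'cev if $J(x,y,xz)=J(x,y,z)x$, where $J(x,y,z)=(xy)z-x(yz)+y(xz)$. The conformal algebra $C$ is called anti-commutative (respectively, Mal'cev) if $\mathrm{Coeff}\,C$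 is. Let $\Delta^{(n)}:H\to H^{\otimes n}$ be the iterated coproduct, let $H$ act on $H^{\otimes n}$ from the right through $\Delta^{(n)}$, and for $a,b\in C$ put $a*b=\sum_{s\ge 0}\bigl(\tfrac{(-D)^s}{s!}\otimes 1\bigr)\otimes_H(a\,{}_{(s)}\,b)\in (H\otimes H)\otimes_H C$. The expanded pseudoproduct $(H^{\otimes n}\otimes_H C)\times(H^{\otimes m}\otimes_H C)\to H^{\otimes(n+m)}\otimes_H C$, $n,m\ge1$, is given by $$(F\otimes_H a)*(G\otimes_H b)=(F\otimes G\otimes_H 1)\,(\Delta^{(n)}\otimes\Delta^{(m)}\otimes_H \mathrm{id})(a*b),$$ and $C$ is identified with $H\otimes_H C$. For $A,B,E$ in $H^{\otimes n}\otimes_H C$, $H^{\otimes m}\otimes_H C$, $H^{\otimes p}\otimes_H C$, respectively, put $$J^*(A,B,E)=(A*B)*E-A*(B*E)+(\sigma_{12}\otimes_H\mathrm{id})(B*(A*E)),$$ where $\sigma_{12}$ interchanges the block of $m$ tensor factors belonging to $B$ with the block of $n$ tensor factors belonging to $A$ (for $A,B,E\in C$ it is the transposition of the first two factors of $H^{\otimes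 3}$). Then an anti-commutative conformal algebra $C$ is a Mal'cev conformal algebra if and only if for all $a,b,c,d\in C$ the following identity holds in $H^{\otimes 4}\otimes_H C$: $$-J^*(a,b,c*d)-J^*(a,b,c)*d=(\sigma_{23}\otimes_H\mathrm{id})\bigl(a*J^*(c,b,d)+J^*(a*c,b,d)\bigr),$$ where $\sigma_{23}$ is the transposition of the second and the third tensor factors. -/

import Mathlib

open scoped Polynomial TensorProduct LaurentPolynomial

/-- A conformal algebra over `k`: a unital `k[D]`-module `C` (the variable `X` of `k[X]` plays the
role of `D`) with `k`-bilinear `n`-products, `n ≥ 0`, satisfying locality and sesqui-linearity.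
In the two sesqui-linearity axioms the term with `n - 1` is absent for `n = 0`, because its
coefficient is `n = 0`. -/
class ConformalAlgebra (k C : Type*) [Field k] [AddCommGroup C] [Module k C] [Module k[X] C]
    [IsScalarTower k k[X] C] where
  /-- The `n`-product `a ₍ₙ₎ b`. -/
  nprod : ℕ → C →ₗ[k] C →ₗ[k] C
  locality : ∀ a b : C, ∃ N : ℕ, ∀ n : ℕ, N ≤ n → nprod n a b = 0
  nprod_D_left : ∀ (n : ℕ) (a b : C),
    nprod n ((Polynomial.X : k[X]) • a) b = -((n : k) • nprod (n - 1) a b)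
  nprod_D_right : ∀ (n : ℕ) (a b : C),
    nprod n a ((Polynomial.X : k[X]) • b) =
      (Polynomial.X : k[X]) • nprod n a b + (n : k) • nprod (n - 1) a b

namespace Conformal

noncomputable section

/-! ## Sums over the `n`-products -/

section LocSum

variable (k : Type*) {C : Type*} [Field k] [AddCommGroup C] [Module k C] [Module k[X] C]
  [IsScalarTower k k[X] C] [ConformalAlgebra k C] {P : Type*} [AddCommGroup P]

/-- The sum `∑ₛ φₛ (a ₍ₛ₎ b)` over all `s ≥ 0`; it is finite by locality. -/
def locSum (φ : ℕ → C →+ P) (a b : C) : P :=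
  ∑ᶠ s : ℕ, φ s (ConformalAlgebra.nprod (k := k) s a b)

theorem locSum_eq (φ : ℕ → C →+ P) (a b : C) (N : ℕ)
    (h : ∀ n, N ≤ n → ConformalAlgebra.nprod (k := k) n a b = 0) :
    locSum k φ a b = ∑ s ∈ Finset.range N, φ s (ConformalAlgebra.nprod (k := k) s a b) := by
  unfold locSum
  apply finsum_eq_sum_of_support_subset
  intro s hs
  simp only [Finset.coe_range, Set.mem_Iio]
  by_contra hlt
  exact hs (by simp [h s (not_lt.mp hlt)])

theorem locSum_add_left (φ : ℕ → C →+ P) (a a' b : C) :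
    locSum k φ (a + a') b = locSum k φ a b + locSum k φ a' b := by
  obtain ⟨N, hN⟩ := ConformalAlgebra.locality (k := k) a b
  obtain ⟨M, hM⟩ := ConformalAlgebra.locality (k := k) a' b
  rw [locSum_eq k φ a b (max N M) fun n hn => hN n (le_trans (le_max_left _ _) hn),
    locSum_eq k φ a' b (max N M) fun n hn => hM n (le_trans (le_max_right _ _) hn),
    locSum_eq k φ (a + a') b (max N M), ← Finset.sum_add_distrib]
  · simp
  · intro n hn
    simp [hN n (le_trans (le_max_left _ _) hn), hM n (le_trans (le_max_right _ _) hn)]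

theorem locSum_add_right (φ : ℕ → C →+ P) (a b b' : C) :
    locSum k φ a (b + b') = locSum k φ a b + locSum k φ a b' := by
  obtain ⟨N, hN⟩ := ConformalAlgebra.locality (k := k) a b
  obtain ⟨M, hM⟩ := ConformalAlgebra.locality (k := k) a b'
  rw [locSum_eq k φ a b (max N M) fun n hn => hN n (le_trans (le_max_left _ _) hn),
    locSum_eq k φ a b' (max N M) fun n hn => hM n (le_trans (le_max_right _ _) hn),
    locSum_eq k φ a (b + b') (max N M), ← Finset.sum_add_distrib]
  · simp
  · intro n hn
    simp [hN n (le_trans (le_max_left _ _) hn), hM n (le_trans (le_max_right _ _) hn)]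

theorem locSum_add_fun (φ ψ : ℕ → C →+ P) (a b : C) :
    locSum k (fun s => φ s + ψ s) a b = locSum k φ a b + locSum k ψ a b := by
  obtain ⟨N, hN⟩ := ConformalAlgebra.locality (k := k) a b
  rw [locSum_eq k _ a b N hN, locSum_eq k _ a b N hN, locSum_eq k _ a b N hN,
    ← Finset.sum_add_distrib]
  simp

theorem locSum_comp {Q : Type*} [AddCommGroup Q] (g : P →+ Q) (φ : ℕ → C →+ P) (a b : C) :
    g (locSum k φ a b) = locSum k (fun s => g.comp (φ s)) a b := by
  obtain ⟨N, hN⟩ := ConformalAlgebra.locality (k := k) a b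
  rw [locSum_eq k _ a b N hN, locSum_eq k _ a b N hN, map_sum]
  simp

theorem locSum_smul_left (φ : ℕ → C →+ P) (r : k) (a b : C) :
    locSum k φ (r • a) b =
      locSum k (fun s => (φ s).comp (DistribSMul.toAddMonoidHom C r)) a b := by
  simp [locSum]

theorem locSum_smul_right (φ : ℕ → C →+ P) (r : k) (a b : C) :
    locSum k φ a (r • b) =
      locSum k (fun s => (φ s).comp (DistribSMul.toAddMonoidHom C r)) a b := by
  simp [locSum]

theorem locSum_D_left (φ : ℕ → C →+ P) (a b : C) :
    locSum k φ ((Polynomial.X : k[X]) • a) b =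
      -locSum k (fun s => (s + 1) • φ (s + 1)) a b := by
  obtain ⟨N, hN⟩ := ConformalAlgebra.locality (k := k) a b
  rw [locSum_eq k _ a b N hN, locSum_eq k _ _ b (N + 1), Finset.sum_range_succ']
  · simp only [ConformalAlgebra.nprod_D_left, map_neg, Finset.sum_neg_distrib]
    simp [Nat.cast_smul_eq_nsmul, -Nat.cast_add]
  · intro n hn
    rw [ConformalAlgebra.nprod_D_left, hN (n - 1) (by omega)]
    simp

theorem locSum_D_right (φ : ℕ → C →+ P) (a b : C) :
    locSum k φ a ((Polynomial.X : k[X]) • b) =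
      locSum k (fun s => (φ s).comp
        (DistribSMul.toAddMonoidHom C (Polynomial.X : k[X]))) a b +
      locSum k (fun s => (s + 1) • φ (s + 1)) a b := by
  obtain ⟨N, hN⟩ := ConformalAlgebra.locality (k := k) a b
  rw [locSum_eq k _ a b (N + 1) fun n hn => hN n (by omega), locSum_eq k _ a b N hN,
    locSum_eq k _ a _ (N + 1)]
  · simp only [ConformalAlgebra.nprod_D_right, map_add, Finset.sum_add_distrib]
    congr 1
    rw [Finset.sum_range_succ']
    simp [Nat.cast_smul_eq_nsmul, -Nat.cast_add]
  · intro n hn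
    rw [ConformalAlgebra.nprod_D_right, hN (n - 1) (by omega), hN n (by omega)]
    simp

/-- A biadditive map from a function of two arguments additive in each of them. -/
def biadd {M N : Type*} [AddCommGroup M] [AddCommGroup N] (f : M → N → P)
    (hl : ∀ m m' n, f (m + m') n = f m n + f m' n)
    (hr : ∀ m n n', f m (n + n') = f m n + f m n') : M →+ N →+ P :=
  AddMonoidHom.mk' (fun m => AddMonoidHom.mk' (f m) (hr m)) fun m m' => by
    ext n; exact hl m m' n

@[simp] theorem biadd_apply {M N : Type*} [AddCommGroup M] [AddCommGroup N] (f : M → N → P)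
    (hl hr) (m : M) (n : N) : biadd f hl hr m n = f m n := rfl

theorem balanced_of_X {M N : Type*} [AddCommGroup M] [AddCommGroup N] [Module k[X] M]
    [Module k[X] N] (f : M →+ N →+ P)
    (hC : ∀ (r : k) (m : M) (n : N), f (Polynomial.C r • m) n = f m (Polynomial.C r • n))
    (hX : ∀ (m : M) (n : N), f ((Polynomial.X : k[X]) • m) n = f m ((Polynomial.X : k[X]) • n))
    (p : k[X]) (m : M) (n : N) : f (p • m) n = f m (p • n) := by
  induction p using Polynomial.induction_on generalizing m n with
  | C r => exact hC r m n
  | add p q hp hq => simp [add_smul, hp, hq]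
  | monomial i r ih =>
    rw [pow_succ, ← mul_assoc, mul_smul, ih, hX, ← mul_smul, mul_comm]

end LocSum

/-! ## The coefficient algebra -/

section Coeff

variable (k : Type*) [Field k]

/-- The linear operator `tⁿ ↦ binom(n, s) tⁿ⁻ˢ` on `k[t, t⁻¹]`. -/
def hasse (s : ℕ) : k[T;T⁻¹] →ₗ[k] k[T;T⁻¹] :=
  (Finsupp.lsum k fun n : ℤ =>
    LinearMap.toSpanSingleton k _ (((Ring.choose n s : ℤ) : k) • LaurentPolynomial.T (n - s))) ∘ₗ
  (AddMonoidAlgebra.coeffLinearEquiv k).toLinearMap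

/-- The operator `tⁿ ↦ -n tⁿ⁻¹` by which `D` acts on `k[t, t⁻¹]`. -/
def actD : k[T;T⁻¹] →ₗ[k] k[T;T⁻¹] :=
  (Finsupp.lsum k fun n : ℤ =>
    LinearMap.toSpanSingleton k _ (-((n : k) • LaurentPolynomial.T (n - 1)))) ∘ₗ
  (AddMonoidAlgebra.coeffLinearEquiv k).toLinearMap


@[simp] theorem hasse_T (s : ℕ) (n : ℤ) :
    hasse k s (LaurentPolynomial.T n) =
      ((Ring.choose n s : ℤ) : k) • LaurentPolynomial.T (n - s) := by
  rw [hasse, LinearMap.comp_apply]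
  refine (Finsupp.sum_single_index ?_).trans ?_ <;> simp

@[simp] theorem actD_T (n : ℤ) :
    actD k (LaurentPolynomial.T n) = -((n : k) • LaurentPolynomial.T (n - 1)) := by
  rw [actD, LinearMap.comp_apply]
  refine (Finsupp.sum_single_index ?_).trans ?_ <;> simp

theorem laurent_ext {M : Type*} [AddCommGroup M] [Module k M] {f g : k[T;T⁻¹] →ₗ[k] M}
    (h : ∀ n : ℤ, f (LaurentPolynomial.T n) = g (LaurentPolynomial.T n)) : f = g := by
  refine LinearMap.ext fun x => ?_
  induction x using LaurentPolynomial.induction_on' with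
  | add p q hp hq => simp [hp, hq]
  | C_mul_T n a => rw [← LaurentPolynomial.smul_eq_C_mul]; simp [h]

theorem choose_succ_int (n : ℤ) (s : ℕ) :
    ((s : ℤ) + 1) * Ring.choose n (s + 1) = (n - s) * Ring.choose n s := by
  have h := Ring.choose_smul_choose n (Nat.le_succ s)
  rw [Nat.succ_eq_add_one, Nat.choose_succ_self_right, Nat.add_sub_cancel_left,
    Ring.choose_one_right] at h
  rw [nsmul_eq_mul] at h
  push_cast at h
  linarith

theorem choose_pred_int (n : ℤ) (s : ℕ) :
    n * Ring.choose (n - 1) s = ((s : ℤ) + 1) * Ring.choose n (s + 1) := by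
  have h := Ring.choose_smul_choose n (Nat.le_add_left 1 s)
  rw [Nat.choose_one_right, Nat.add_sub_cancel, Ring.choose_one_right, nsmul_eq_mul] at h
  push_cast at h
  linarith

theorem hasse_actD (s : ℕ) (x : k[T;T⁻¹]) :
    hasse k s (actD k x) = -((s + 1) • hasse k (s + 1) x) := by
  suffices h : hasse k s ∘ₗ actD k = -((s + 1) • hasse k (s + 1)) from LinearMap.congr_fun h x
  refine laurent_ext k fun n => ?_
  have h := congrArg (Int.cast : ℤ → k) (choose_pred_int n s)
  push_cast at h
  simp only [LinearMap.comp_apply, actD_T, map_neg, map_smul, hasse_T, smul_smul, h,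
    LinearMap.neg_apply, LinearMap.smul_apply, ← Nat.cast_smul_eq_nsmul k]
  push_cast
  rw [sub_sub, add_comm (1 : ℤ)]

theorem actD_hasse (s : ℕ) (x : k[T;T⁻¹]) :
    actD k (hasse k s x) = -((s + 1) • hasse k (s + 1) x) := by
  suffices h : actD k ∘ₗ hasse k s = -((s + 1) • hasse k (s + 1)) from LinearMap.congr_fun h x
  refine laurent_ext k fun n => ?_
  have h := congrArg (Int.cast : ℤ → k) (choose_succ_int n s)
  push_cast at h
  simp only [LinearMap.comp_apply, actD_T, smul_neg, map_smul, hasse_T, smul_smul,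
    LinearMap.neg_apply, LinearMap.smul_apply, ← Nat.cast_smul_eq_nsmul k]
  push_cast
  rw [h, sub_sub, mul_comm]

theorem actD_mul (x y : k[T;T⁻¹]) : actD k (x * y) = actD k x * y + x * actD k y := by
  induction x using LaurentPolynomial.induction_on' with
  | add p q hp hq => simp only [add_mul, map_add, hp, hq]; abel
  | C_mul_T n a =>
    induction y using LaurentPolynomial.induction_on' with
    | add p q hp hq => simp only [mul_add, map_add, hp, hq]; abel
    | C_mul_T m b =>
      simp only [← LaurentPolynomial.smul_eq_C_mul, map_smul,
        ← LaurentPolynomial.T_add, actD_T, mul_neg, neg_mul, mul_smul_comm, smul_mul_assoc]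
      rw [show n - 1 + m = n + m - 1 by ring, show n + (m - 1) = n + m - 1 by ring]
      push_cast
      module

variable (C : Type*) [AddCommGroup C] [Module k[X] C]

/-- The underlying space `k[t, t⁻¹] ⊗_H C` of the coefficient algebra, where `H = k[D]` acts on
`k[t, t⁻¹]` by `tⁿ D = -n tⁿ⁻¹`. As `H` is commutative, right and left `H`-modules agree. -/
def Coeff : Type _ := Module.AEval' (actD k) ⊗[k[X]] C

instance : AddCommGroup (Coeff k C) :=
  inferInstanceAs (AddCommGroup (Module.AEval' (actD k) ⊗[k[X]] C))

instance : Module k (Coeff k C) :=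
  inferInstanceAs (Module k (Module.AEval' (actD k) ⊗[k[X]] C))

variable {C}

/-- The additive map `a ↦ a(x) = x ⊗_H a`, also additive in `x`. -/
def Coeff.mk : k[T;T⁻¹] →+ C →+ Coeff k C :=
  biadd (fun x a =>
      (Module.AEval'.of (actD k) x ⊗ₜ[k[X]] a : Module.AEval' (actD k) ⊗[k[X]] C))
    (fun x y a => (congrArg (· ⊗ₜ[k[X]] a) (map_add (Module.AEval'.of (actD k)) x y)).trans
      (TensorProduct.add_tmul _ _ _))
    (fun _ _ _ => TensorProduct.tmul_add _ _ _)

theorem Coeff.mk_actD (x : k[T;T⁻¹]) (a : C) :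
    Coeff.mk k (actD k x) a = Coeff.mk k x ((Polynomial.X : k[X]) • a) := by
  change Module.AEval'.of (actD k) (actD k x) ⊗ₜ[k[X]] a =
    Module.AEval'.of (actD k) x ⊗ₜ[k[X]] _
  rw [← Module.AEval'.X_smul_of, TensorProduct.smul_tmul]

theorem Coeff.mk_smul [Module k C] [IsScalarTower k k[X] C] (r : k) (x : k[T;T⁻¹]) (a : C) :
    Coeff.mk k (r • x) a = Coeff.mk k x (r • a) := by
  change Module.AEval'.of (actD k) (r • x) ⊗ₜ[k[X]] a =
    Module.AEval'.of (actD k) x ⊗ₜ[k[X]] _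
  rw [map_smul, ← Module.AEval.C_smul, TensorProduct.smul_tmul, ← Polynomial.algebraMap_eq,
    algebraMap_smul]

theorem Coeff.smul_mk (r : k) (x : k[T;T⁻¹]) (a : C) :
    r • Coeff.mk k x a = Coeff.mk k (r • x) a := by
  change r • (Module.AEval'.of (actD k) x ⊗ₜ[k[X]] a) =
    Module.AEval'.of (actD k) (r • x) ⊗ₜ[k[X]] a
  rw [map_smul, TensorProduct.smul_tmul']

theorem Coeff.induction_on {motive : Coeff k C → Prop} (u : Coeff k C)
    (mk : ∀ x a, motive (Coeff.mk k x a))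
    (add : ∀ u v, motive u → motive v → motive (u + v)) : motive u := by
  refine TensorProduct.induction_on (motive := motive) u ?_ (fun x a => ?_) add
  · have h := mk 0 0
    rwa [map_zero] at h
  · exact mk ((Module.AEval'.of (actD k)).symm x) a

/-- Extend a balanced biadditive map `(x, a) ↦ f x a` to the coefficient space. -/
def Coeff.lift {P : Type*} [AddCommGroup P] (f : k[T;T⁻¹] →+ C →+ P)
    (hC : ∀ (r : k) (x : k[T;T⁻¹]) (a : C), f (r • x) a = f x (Polynomial.C r • a))
    (hX : ∀ (x : k[T;T⁻¹]) (a : C), f (actD k x) a = f x ((Polynomial.X : k[X]) • a)) :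
    Coeff k C →+ P :=
  TensorProduct.liftAddHom (R := k[X])
    (f.comp (Module.AEval'.of (actD k)).symm.toLinearMap.toAddMonoidHom)
    (balanced_of_X k _ (fun r m n => by simpa using hC r _ n) (fun m n => by
      have h := hX ((Module.AEval'.of (actD k)).symm m) n
      simpa [Module.AEval'.of_symm_X_smul] using h))

@[simp] theorem Coeff.lift_mk {P : Type*} [AddCommGroup P] (f : k[T;T⁻¹] →+ C →+ P) (hC hX)
    (x : k[T;T⁻¹]) (a : C) : Coeff.lift k f hC hX (Coeff.mk k x a) = f x a := by
  change f ((Module.AEval'.of (actD k)).symm (Module.AEval'.of (actD k) x)) a = _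
  simp

theorem Coeff.hom_ext {P : Type*} [AddCommGroup P] {f g : Coeff k C →+ P}
    (h : ∀ x a, f (Coeff.mk k x a) = g (Coeff.mk k x a)) : f = g := by
  ext u
  induction u using Coeff.induction_on with
  | mk x a => exact h x a
  | add u v hu hv => simp [hu, hv]

variable [Module k C] [IsScalarTower k k[X] C] [ConformalAlgebra k C]

/-- The product `a(x) b(y) = ∑ₛ (a ₍ₛ₎ b)(x⁽ˢ⁾ y)`, where `x ↦ x⁽ˢ⁾` is `tⁿ ↦ binom(n, s) tⁿ⁻ˢ`. -/
def Coeff.mulAux (x : k[T;T⁻¹]) (a : C) (y : k[T;T⁻¹]) (b : C) : Coeff k C :=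
  locSum k (fun s => Coeff.mk k (hasse k s x * y)) a b

/-- Left multiplication by `a(x)`. -/
def Coeff.mulLeftMk (x : k[T;T⁻¹]) (a : C) : Coeff k C →+ Coeff k C :=
  Coeff.lift k
    (biadd (fun y b => Coeff.mulAux k x a y b)
      (fun y y' b => by
        simp only [Coeff.mulAux, mul_add, map_add]
        exact locSum_add_fun k _ _ a b)
      (fun y b b' => locSum_add_right k _ a b b'))
    (fun r y b => by
      simp only [biadd_apply, Coeff.mulAux]
      rw [← Polynomial.algebraMap_eq, algebraMap_smul, locSum_smul_right]
      congr 1; ext s c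
      simp [Coeff.mk_smul])
    (fun y b => by
      simp only [biadd_apply, Coeff.mulAux]
      rw [locSum_D_right, ← locSum_add_fun]
      congr 1; ext s c
      have h : hasse k s x * actD k y =
          actD k (hasse k s x * y) + (s + 1) • (hasse k (s + 1) x * y) := by
        rw [actD_mul, actD_hasse, neg_mul, smul_mul_assoc]; abel
      rw [h, map_add, map_nsmul]
      simp [Coeff.mk_actD])

@[simp] theorem Coeff.mulLeftMk_mk (x : k[T;T⁻¹]) (a : C) (y : k[T;T⁻¹]) (b : C) :
    Coeff.mulLeftMk k x a (Coeff.mk k y b) = Coeff.mulAux k x a y b :=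
  Coeff.lift_mk k _ _ _ y b

/-- The multiplication of the coefficient algebra as a biadditive map. -/
def Coeff.mulHom : Coeff k C →+ Coeff k C →+ Coeff k C :=
  Coeff.lift k
    (biadd (fun x a => Coeff.mulLeftMk k x a)
      (fun x x' a => Coeff.hom_ext k fun y b => by
        simp only [AddMonoidHom.add_apply, Coeff.mulLeftMk_mk, Coeff.mulAux, map_add, add_mul]
        exact locSum_add_fun k _ _ a b)
      (fun x a a' => Coeff.hom_ext k fun y b => by
        simp only [AddMonoidHom.add_apply, Coeff.mulLeftMk_mk]
        exact locSum_add_left k _ a a' b))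
    (fun r x a => Coeff.hom_ext k fun y b => by
      simp only [biadd_apply, Coeff.mulLeftMk_mk, Coeff.mulAux]
      rw [← Polynomial.algebraMap_eq, algebraMap_smul, locSum_smul_left]
      congr 1; ext s c
      simp [Coeff.mk_smul])
    (fun x a => Coeff.hom_ext k fun y b => by
      simp only [biadd_apply, Coeff.mulLeftMk_mk, Coeff.mulAux]
      rw [locSum_D_left]
      simp only [hasse_actD, neg_mul, smul_mul_assoc, map_neg, map_nsmul]
      simp [locSum, finsum_neg_distrib])

/-- The coefficient algebra `Coeff C` as a nonassociative ring; with the module structure above it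
is an algebra over `k`. -/
instance : NonUnitalNonAssocRing (Coeff k C) where
  mul u v := Coeff.mulHom k u v
  left_distrib u v w := map_add (Coeff.mulHom k u) v w
  right_distrib u v w := by
    change Coeff.mulHom k (u + v) w = _
    rw [map_add]; rfl
  zero_mul u := by
    change Coeff.mulHom k 0 u = 0
    rw [map_zero]; rfl
  mul_zero u := map_zero (Coeff.mulHom k u)

theorem Coeff.mk_mul_mk (x y : k[T;T⁻¹]) (a b : C) :
    Coeff.mk k x a * Coeff.mk k y b = locSum k (fun s => Coeff.mk k (hasse k s x * y)) a b := by
  change Coeff.mulHom k _ _ = _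
  simp [Coeff.mulHom, Coeff.mulAux]

instance : IsScalarTower k (Coeff k C) (Coeff k C) where
  smul_assoc r u v := by
    induction u using Coeff.induction_on with
    | add u u' hu hu' => simp only [smul_eq_mul, smul_add, add_mul] at *; rw [hu, hu']
    | mk x a =>
      induction v using Coeff.induction_on with
      | add v v' hv hv' => simp only [smul_eq_mul, smul_add, mul_add] at *; rw [hv, hv']
      | mk y b =>
        simp only [smul_eq_mul, Coeff.smul_mk, Coeff.mk_mul_mk]
        refine Eq.trans ?_ (locSum_comp k (DistribSMul.toAddMonoidHom _ r) _ a b).symm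
        congr 1; ext s c
        simp [Coeff.smul_mk]

instance : SMulCommClass k (Coeff k C) (Coeff k C) where
  smul_comm r u v := by
    induction u using Coeff.induction_on with
    | add u u' hu hu' => simp only [smul_eq_mul, smul_add, add_mul] at *; rw [hu, hu']
    | mk x a =>
      induction v using Coeff.induction_on with
      | add v v' hv hv' => simp only [smul_eq_mul, smul_add, mul_add] at *; rw [hv, hv']
      | mk y b =>
        simp only [smul_eq_mul, Coeff.smul_mk, Coeff.mk_mul_mk]
        refine Eq.trans (locSum_comp k (DistribSMul.toAddMonoidHom _ r) _ a b) ?_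
        congr 1; ext s c
        simp [Coeff.smul_mk]

/-- The element `a(n) = tⁿ ⊗_H a`. -/
def Coeff.coeff (a : C) (n : ℤ) : Coeff k C := Coeff.mk k (LaurentPolynomial.T n) a

/-- The multiplication rule `a(n) b(m) = ∑ₛ binom(n, s) (a ₍ₛ₎ b)(n + m - s)`. -/
theorem Coeff.coeff_mul_coeff (a b : C) (n m : ℤ) :
    Coeff.coeff k a n * Coeff.coeff k b m =
      ∑ᶠ s : ℕ, ((Ring.choose n s : ℤ) : k) •
        Coeff.coeff k (ConformalAlgebra.nprod (k := k) s a b) (n + m - s) := by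
  simp only [Coeff.coeff, Coeff.mk_mul_mk, locSum, hasse_T, Coeff.smul_mk, smul_mul_assoc,
    ← LaurentPolynomial.T_add]
  refine finsum_congr fun s => ?_
  rw [show n - (s : ℤ) + m = n + m - s by ring]

end Coeff

/-! ## Tensor powers of `H = k[D]` and the pseudoproduct -/

section Pseudo

/-- The tensor power `H^{⊗ n}` of `H = k[D]` over `k`. -/
def HPow (k : Type*) [Field k] (n : ℕ) : Type _ := PiTensorProduct k fun _ : Fin n => k[X]

variable {k : Type*} [Field k] {n m p : ℕ}

instance : CommRing (HPow k n) := inferInstanceAs (CommRing (PiTensorProduct k fun _ => k[X]))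

instance : Algebra k (HPow k n) := inferInstanceAs (Algebra k (PiTensorProduct k fun _ => k[X]))

/-- The pure tensor `f₁ ⊗ ⋯ ⊗ fₙ`. -/
def HPow.tprod (f : Fin n → k[X]) : HPow k n := PiTensorProduct.tprod k f

/-- `f ↦ 1 ⊗ ⋯ ⊗ f ⊗ ⋯ ⊗ 1` with `f` in the `i`-th place. -/
def HPow.incl (i : Fin n) : k[X] →ₐ[k] HPow k n :=
  PiTensorProduct.singleAlgHom (A := fun _ : Fin n => k[X]) i

/-- The algebra homomorphism `f₁ ⊗ ⋯ ⊗ fₙ ↦ g₁(f₁) ⋯ gₙ(fₙ)`. -/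
def HPow.lift {A : Type*} [CommRing A] [Algebra k A] (g : Fin n → (k[X] →ₐ[k] A)) :
    HPow k n →ₐ[k] A :=
  PiTensorProduct.liftAlgHom
    ((MultilinearMap.mkPiAlgebra k (Fin n) A).compLinearMap fun i => (g i).toLinearMap)
    (by simp) (by intro x y; simp [Finset.prod_mul_distrib])

theorem HPow.lift_tprod {A : Type*} [CommRing A] [Algebra k A] (g : Fin n → (k[X] →ₐ[k] A))
    (f : Fin n → k[X]) : HPow.lift g (HPow.tprod f) = ∏ i, g i (f i) :=
  (PiTensorProduct.lift.tprod _).trans (by simp)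

theorem HPow.prod_incl (f : Fin n → k[X]) : ∏ i, HPow.incl i (f i) = HPow.tprod f := by
  have h := map_prod (PiTensorProduct.tprodMonoidHom k (A := fun _ : Fin n => k[X]))
    (fun i => Pi.mulSingle i (f i)) Finset.univ
  rw [Finset.univ_prod_mulSingle] at h
  exact h.symm

theorem HPow.incl_eq_tprod (i : Fin n) (f : k[X]) :
    HPow.incl i f = HPow.tprod (Pi.mulSingle i f) := rfl

@[simp] theorem HPow.lift_incl {A : Type*} [CommRing A] [Algebra k A]
    (g : Fin n → (k[X] →ₐ[k] A)) (i : Fin n) (f : k[X]) :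
    HPow.lift g (HPow.incl i f) = g i f := by
  rw [HPow.incl_eq_tprod, HPow.lift_tprod, Finset.prod_eq_single i]
  · simp
  · intro j _ hj; simp [Pi.mulSingle_eq_of_ne hj]
  · simp

variable (k n) in
/-- The iterated coproduct `Δ⁽ⁿ⁾ : H → H^{⊗ n}`: the algebra homomorphism with
`Δ⁽ⁿ⁾(D) = D ⊗ 1 ⊗ ⋯ ⊗ 1 + ⋯ + 1 ⊗ ⋯ ⊗ 1 ⊗ D`. -/
def HPow.comul : k[X] →ₐ[k] HPow k n := Polynomial.aeval (∑ i : Fin n, HPow.incl i Polynomial.X)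

/-- The action of `H` on `H^{⊗ n}`: `(f₁ ⊗ ⋯ ⊗ fₙ) h = (f₁ ⊗ ⋯ ⊗ fₙ) Δ⁽ⁿ⁾(h)`. As `H` is
commutative, right and left `H`-modules agree. -/
instance : Algebra k[X] (HPow k n) := (HPow.comul k n).toAlgebra

theorem HPow.algebraMap_eq (f : k[X]) : algebraMap k[X] (HPow k n) f = HPow.comul k n f := rfl

theorem HPow.smul_eq (f : k[X]) (F : HPow k n) : f • F = HPow.comul k n f * F :=
  Algebra.smul_def f F

instance : IsScalarTower k k[X] (HPow k n) :=
  IsScalarTower.of_algebraMap_eq fun r => ((HPow.comul k n).commutes r).symm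

/-- An algebra homomorphism compatible with the iterated coproducts is `H`-linear. -/
def HPow.ofComul (g : HPow k n →ₐ[k] HPow k m)
    (h : g (∑ i : Fin n, HPow.incl i Polynomial.X) = ∑ i : Fin m, HPow.incl i Polynomial.X) :
    HPow k n →ₐ[k[X]] HPow k m :=
  { g with
    commutes' := fun f => by
      have e : g.comp (HPow.comul k n) = HPow.comul k m := by
        apply Polynomial.algHom_ext
        simpa [HPow.comul] using h
      exact AlgHom.congr_fun e f }

@[simp] theorem HPow.ofComul_apply (g : HPow k n →ₐ[k] HPow k m) (h) (F : HPow k n) :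
    HPow.ofComul g h F = g F := rfl

/-- The permutation of tensor factors along a bijection `e`: it moves the `i`-th factor to the
place `e i`. It is `H`-linear because `H` is cocommutative. -/
def HPow.perm (e : Fin n ≃ Fin m) : HPow k n →ₐ[k[X]] HPow k m :=
  HPow.ofComul (HPow.lift fun i => HPow.incl (e i)) (by
    simp only [map_sum, HPow.lift_incl]
    exact e.sum_comp fun i => HPow.incl i (Polynomial.X : k[X]))

theorem HPow.perm_tprod (e : Fin n ≃ Fin m) (f : Fin n → k[X]) :
    HPow.perm e (HPow.tprod f) = HPow.tprod (f ∘ e.symm) := by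
  rw [HPow.perm, HPow.ofComul_apply, HPow.lift_tprod, ← HPow.prod_incl, ← e.prod_comp]
  simp

/-- `F ↦ F ⊗ 1 ⊗ ⋯ ⊗ 1` from `H^{⊗ n}` to `H^{⊗ (n + m)}`. -/
def HPow.inl : HPow k n →ₐ[k] HPow k (n + m) := HPow.lift fun i => HPow.incl (Fin.castAdd m i)

/-- `G ↦ 1 ⊗ ⋯ ⊗ 1 ⊗ G` from `H^{⊗ m}` to `H^{⊗ (n + m)}`. -/
def HPow.inr : HPow k m →ₐ[k] HPow k (n + m) := HPow.lift fun i => HPow.incl (Fin.natAdd n i)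

/-- `F ⊗ G ∈ H^{⊗ (n + m)}` for `F ∈ H^{⊗ n}` and `G ∈ H^{⊗ m}`. -/
def HPow.tmul (F : HPow k n) (G : HPow k m) : HPow k (n + m) := HPow.inl F * HPow.inr G

theorem HPow.tmul_tprod (f : Fin n → k[X]) (g : Fin m → k[X]) :
    HPow.tmul (HPow.tprod f) (HPow.tprod g) = HPow.tprod (Fin.append f g) := by
  rw [HPow.tmul, HPow.inl, HPow.inr, HPow.lift_tprod, HPow.lift_tprod, ← HPow.prod_incl,
    Fin.prod_univ_add]
  simp

variable (k n m) in
/-- The `H`-linear map `Δ⁽ⁿ⁾ ⊗ Δ⁽ᵐ⁾ : H ⊗ H → H^{⊗ (n + m)}`. -/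
def HPow.comul₂ : HPow k 2 →ₐ[k[X]] HPow k (n + m) :=
  HPow.ofComul
    (HPow.lift ![HPow.inl.comp (HPow.comul k n), HPow.inr.comp (HPow.comul k m)]) (by
    simp [Fin.sum_univ_two, Fin.sum_univ_add, HPow.comul, HPow.inl, HPow.inr])

theorem HPow.comul₂_tprod (f g : k[X]) :
    HPow.comul₂ k n m (HPow.tprod ![f, g]) = HPow.tmul (HPow.comul k n f) (HPow.comul k m g) := by
  rw [HPow.comul₂, HPow.ofComul_apply, HPow.lift_tprod]
  simp [Fin.prod_univ_two, HPow.tmul]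

variable (k) in
/-- `H^{⊗ n} ⊗_H C`. -/
abbrev PT (C : Type*) [AddCommGroup C] [Module k[X] C] (n : ℕ) : Type _ := HPow k n ⊗[k[X]] C

section Perm

variable {C : Type*} [AddCommGroup C] [Module k[X] C]

/-- The map `σ ⊗_H id` on `H^{⊗ n} ⊗_H C`. -/
def PT.perm (e : Fin n ≃ Fin m) : PT k C n →+ PT k C m :=
  (LinearMap.rTensor C (HPow.perm (k := k) e).toLinearMap).toAddMonoidHom

/-- The map `Δ⁽ⁿ⁾ ⊗ Δ⁽ᵐ⁾ ⊗_H id` from `(H ⊗ H) ⊗_H C` to `H^{⊗ (n + m)} ⊗_H C`. -/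
def PT.comul₂ (n m : ℕ) : PT k C 2 →+ PT k C (n + m) :=
  (LinearMap.rTensor C (HPow.comul₂ k n m).toLinearMap).toAddMonoidHom

@[simp] theorem PT.perm_tmul (e : Fin n ≃ Fin m) (F : HPow k n) (a : C) :
    PT.perm e (F ⊗ₜ[k[X]] a) = HPow.perm e F ⊗ₜ[k[X]] a := rfl

@[simp] theorem PT.comul₂_tmul (F : HPow k 2) (a : C) :
    PT.comul₂ n m (F ⊗ₜ[k[X]] a) = HPow.comul₂ k n m F ⊗ₜ[k[X]] a := rfl

theorem PT.comul₂_smul (F : HPow k 2) (z : PT k C 2) :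
    PT.comul₂ n m (F • z) = HPow.comul₂ k n m F • PT.comul₂ n m z := by
  induction z using TensorProduct.induction_on with
  | zero => simp
  | tmul G a => simp [TensorProduct.smul_tmul']
  | add u v hu hv => simp only [smul_add, map_add, hu, hv]

variable (k) in
/-- The identification `C = H ⊗_H C`, `a ↦ 1 ⊗_H a`. -/
def PT.of (a : C) : PT k C 1 := (1 : HPow k 1) ⊗ₜ[k[X]] a

theorem PT.hom_ext {P : Type*} [AddCommGroup P] {f g : PT k C n →+ P}
    (h : ∀ (F : HPow k n) (a : C), f (F ⊗ₜ[k[X]] a) = g (F ⊗ₜ[k[X]] a)) : f = g := by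
  ext u
  induction u using TensorProduct.induction_on with
  | zero => simp
  | tmul F a => exact h F a
  | add u v hu hv => simp [hu, hv]

variable (k) in
/-- The divided power `(-D)ˢ / s!`. -/
def divPow (s : ℕ) : k[X] := Polynomial.C ((s.factorial : k)⁻¹) * (-Polynomial.X) ^ s

theorem tprod_divPow (f : k[X]) : (HPow.tprod ![f, 1] : HPow k 2) = HPow.incl 0 f := by
  rw [← HPow.prod_incl, Fin.prod_univ_two]; simp

theorem divPow_succ [CharZero k] (s : ℕ) :
    (s + 1) • divPow k (s + 1) = -(Polynomial.X * divPow k s) := by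
  have h : ((s + 1 : ℕ) : k) * (((s + 1).factorial : ℕ) : k)⁻¹ = ((s.factorial : ℕ) : k)⁻¹ := by
    rw [Nat.factorial_succ, Nat.cast_mul, mul_inv, ← mul_assoc,
      mul_inv_cancel₀ (Nat.cast_ne_zero.mpr (Nat.succ_ne_zero s)), one_mul]
  rw [divPow, divPow, ← Nat.cast_smul_eq_nsmul k, Polynomial.smul_eq_C_mul, ← mul_assoc,
    ← Polynomial.C_mul, h]
  ring

theorem smul_divPow_succ [CharZero k] (s : ℕ) (c : C) :
    (s + 1) • ((HPow.tprod ![divPow k (s + 1), 1] : HPow k 2) ⊗ₜ[k[X]] c) =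
      -((HPow.incl 0 Polynomial.X * HPow.tprod ![divPow k s, 1] : HPow k 2) ⊗ₜ[k[X]] c) := by
  rw [tprod_divPow, tprod_divPow, TensorProduct.smul_tmul', ← map_nsmul, divPow_succ, map_neg,
    map_mul, TensorProduct.neg_tmul]

end Perm

variable {C : Type*} [AddCommGroup C] [Module k C] [Module k[X] C]
  [IsScalarTower k k[X] C] [ConformalAlgebra k C]

variable (k) in
/-- The pseudoproduct `a * b = ∑ₛ ((-D)ˢ / s! ⊗ 1) ⊗_H (a ₍ₛ₎ b)` in `(H ⊗ H) ⊗_H C`. -/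
def pseudoProd : C →+ C →+ PT k C 2 :=
  biadd
    (fun a b => locSum k (fun s =>
      (TensorProduct.mk k[X] (HPow k 2) C (HPow.tprod ![divPow k s, 1])).toAddMonoidHom) a b)
    (fun a a' b => locSum_add_left k _ a a' b) (fun a b b' => locSum_add_right k _ a b b')

theorem pseudoProd_eq (a b : C) :
    pseudoProd k a b = ∑ᶠ s : ℕ, (HPow.tprod ![divPow k s, 1] : HPow k 2) ⊗ₜ[k[X]]
      ConformalAlgebra.nprod (k := k) s a b := rfl

theorem pseudoProd_X_left [CharZero k] (a b : C) :
    pseudoProd k ((Polynomial.X : k[X]) • a) b =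
      (HPow.incl 0 Polynomial.X : HPow k 2) • pseudoProd k a b := by
  simp only [pseudoProd, biadd_apply]
  rw [locSum_D_left]
  refine Eq.trans ?_ (locSum_comp k (DistribSMul.toAddMonoidHom (PT k C 2)
    (HPow.incl 0 Polynomial.X : HPow k 2)) _ a b).symm
  simp only [locSum, ← finsum_neg_distrib]
  refine finsum_congr fun s => ?_
  have h := smul_divPow_succ (k := k) s (ConformalAlgebra.nprod (k := k) s a b)
  simpa [TensorProduct.smul_tmul', neg_eq_iff_eq_neg] using h

theorem pseudoProd_X_right [CharZero k] (a b : C) :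
    pseudoProd k a ((Polynomial.X : k[X]) • b) =
      (HPow.incl 1 Polynomial.X : HPow k 2) • pseudoProd k a b := by
  simp only [pseudoProd, biadd_apply]
  rw [locSum_D_right, ← locSum_add_fun]
  refine Eq.trans ?_ (locSum_comp k (DistribSMul.toAddMonoidHom (PT k C 2)
    (HPow.incl 1 Polynomial.X : HPow k 2)) _ a b).symm
  congr 1; ext s c
  have h := smul_divPow_succ (k := k) s c
  simp only [AddMonoidHom.add_apply, AddMonoidHom.comp_apply, AddMonoidHom.smul_apply,
    LinearMap.toAddMonoidHom_coe, TensorProduct.mk_apply, DistribSMul.toAddMonoidHom_apply]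
  rw [h, ← TensorProduct.smul_tmul, HPow.smul_eq, HPow.comul, Polynomial.aeval_X,
    Fin.sum_univ_two, add_mul, TensorProduct.add_tmul, TensorProduct.smul_tmul', smul_eq_mul]
  abel

theorem pseudoProd_smul_k (r : k) (a b : C) :
    pseudoProd k (r • a) b = algebraMap k (HPow k 2) r • pseudoProd k a b ∧
      pseudoProd k a (r • b) = algebraMap k (HPow k 2) r • pseudoProd k a b := by
  have key : locSum k (fun s => ((TensorProduct.mk k[X] (HPow k 2) C
      (HPow.tprod ![divPow k s, 1])).toAddMonoidHom).comp (DistribSMul.toAddMonoidHom C r)) a b =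
      algebraMap k (HPow k 2) r • pseudoProd k a b := by
    refine Eq.trans ?_ (locSum_comp k (DistribSMul.toAddMonoidHom (PT k C 2)
      (algebraMap k (HPow k 2) r)) _ a b).symm
    congr 1; ext s c
    simp only [AddMonoidHom.comp_apply, LinearMap.toAddMonoidHom_coe, TensorProduct.mk_apply,
      DistribSMul.toAddMonoidHom_apply]
    rw [TensorProduct.smul_tmul', smul_eq_mul, ← Algebra.smul_def, ← algebraMap_smul k[X] r c,
      ← TensorProduct.smul_tmul, algebraMap_smul]
  simp only [pseudoProd, biadd_apply] at key ⊢
  exact ⟨(locSum_smul_left k _ r a b).trans key, (locSum_smul_right k _ r a b).trans key⟩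

/-- The pseudoproduct is `H`-linear in the first argument. -/
theorem pseudoProd_smul_left [CharZero k] (f : k[X]) (a b : C) :
    pseudoProd k (f • a) b = (HPow.incl 0 f : HPow k 2) • pseudoProd k a b := by
  induction f using Polynomial.induction_on generalizing a with
  | C r =>
    rw [← Polynomial.algebraMap_eq, algebraMap_smul, (pseudoProd_smul_k r a b).1,
      AlgHom.commutes]
  | add p q hp hq => simp only [add_smul, map_add, AddMonoidHom.add_apply, hp, hq]
  | monomial i r ih =>
    rw [pow_succ, ← mul_assoc, mul_smul, ih, pseudoProd_X_left, smul_smul, ← map_mul]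

/-- The pseudoproduct is `H`-linear in the second argument. -/
theorem pseudoProd_smul_right [CharZero k] (f : k[X]) (a b : C) :
    pseudoProd k a (f • b) = (HPow.incl 1 f : HPow k 2) • pseudoProd k a b := by
  induction f using Polynomial.induction_on generalizing b with
  | C r =>
    rw [← Polynomial.algebraMap_eq, algebraMap_smul, (pseudoProd_smul_k r a b).2,
      AlgHom.commutes]
  | add p q hp hq => simp only [add_smul, map_add, hp, hq]
  | monomial i r ih =>
    rw [pow_succ, ← mul_assoc, mul_smul, ih, pseudoProd_X_right, smul_smul, ← map_mul]

/-- The right-hand side `(F ⊗ G ⊗_H 1) (Δ⁽ⁿ⁾ ⊗ Δ⁽ᵐ⁾ ⊗_H id)(a * b)` of the definition of the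
expanded pseudoproduct. -/
def expandedAux (F : HPow k n) (a : C) (G : HPow k m) (b : C) : PT k C (n + m) :=
  HPow.tmul F G • PT.comul₂ n m (pseudoProd k a b)

theorem expandedAux_smul_left [CharZero k] (f : k[X]) (F : HPow k n) (a : C) (G : HPow k m)
    (b : C) : expandedAux (f • F) a G b = expandedAux F (f • a) G b := by
  rw [expandedAux, expandedAux, pseudoProd_smul_left, PT.comul₂_smul, smul_smul, HPow.smul_eq]
  congr 1
  simp only [HPow.comul₂, HPow.ofComul_apply, HPow.lift_incl, HPow.tmul, map_mul]
  simp only [Matrix.cons_val_zero, AlgHom.comp_apply]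
  ring

theorem expandedAux_smul_right [CharZero k] (f : k[X]) (F : HPow k n) (a : C) (G : HPow k m)
    (b : C) : expandedAux F a (f • G) b = expandedAux F a G (f • b) := by
  rw [expandedAux, expandedAux, pseudoProd_smul_right, PT.comul₂_smul, smul_smul, HPow.smul_eq]
  congr 1
  simp only [HPow.comul₂, HPow.ofComul_apply, HPow.lift_incl, HPow.tmul, map_mul]
  simp only [Matrix.cons_val_one, Matrix.cons_val_zero, AlgHom.comp_apply]
  ring

/-- Left expanded pseudomultiplication by `F ⊗_H a`. -/
def expandedLeft [CharZero k] (F : HPow k n) (a : C) : PT k C m →+ PT k C (n + m) :=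
  TensorProduct.liftAddHom
    (biadd (fun (G : HPow k m) (b : C) => expandedAux F a G b)
      (fun G G' b => by simp only [expandedAux, HPow.tmul, map_add, mul_add, add_smul])
      (fun G b b' => by simp only [expandedAux, map_add, smul_add]))
    (fun f G b => expandedAux_smul_right f F a G b)

@[simp] theorem expandedLeft_tmul [CharZero k] (F : HPow k n) (a : C) (G : HPow k m) (b : C) :
    expandedLeft F a (G ⊗ₜ[k[X]] b) = expandedAux F a G b := rfl

/-- The expanded pseudoproduct `(H^{⊗ n} ⊗_H C) × (H^{⊗ m} ⊗_H C) → H^{⊗ (n + m)} ⊗_H C`. -/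
def expandedProd [CharZero k] : PT k C n →+ PT k C m →+ PT k C (n + m) :=
  TensorProduct.liftAddHom
    (biadd (fun (F : HPow k n) (a : C) => expandedLeft (m := m) F a)
      (fun F F' a => PT.hom_ext fun G b => by
        simp only [AddMonoidHom.add_apply, expandedLeft_tmul, expandedAux, HPow.tmul, map_add,
          add_mul, add_smul])
      (fun F a a' => PT.hom_ext fun G b => by
        simp only [AddMonoidHom.add_apply, expandedLeft_tmul, expandedAux, map_add, smul_add]))
    (fun f F a => PT.hom_ext fun G b => expandedAux_smul_left f F a G b)

/-- The defining formula
`(F ⊗_H a) * (G ⊗_H b) = (F ⊗ G ⊗_H 1) (Δ⁽ⁿ⁾ ⊗ Δ⁽ᵐ⁾ ⊗_H id)(a * b)`. -/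
theorem expandedProd_tmul [CharZero k] (F : HPow k n) (a : C) (G : HPow k m) (b : C) :
    expandedProd (F ⊗ₜ[k[X]] a : PT k C n) (G ⊗ₜ[k[X]] b : PT k C m) =
      HPow.tmul F G • PT.comul₂ n m (pseudoProd k a b) := rfl

/-- On `C = H ⊗_H C` the expanded pseudoproduct is the pseudoproduct. -/
theorem expandedProd_of [CharZero k] (a b : C) :
    expandedProd (PT.of k a) (PT.of k b) = pseudoProd k a b := by
  rw [PT.of, PT.of, expandedProd_tmul, HPow.tmul, map_one, map_one, one_mul, one_smul]
  have h : PT.comul₂ 1 1 = AddMonoidHom.id (PT k C 2) := PT.hom_ext fun F a => by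
    have e : HPow.comul₂ k 1 1 F = F := by
      suffices e' : (HPow.comul₂ k 1 1).restrictScalars k = AlgHom.id k (HPow k 2) from
        AlgHom.congr_fun e' F
      refine PiTensorProduct.algHom_ext fun i => Polynomial.algHom_ext ?_
      change HPow.comul₂ k 1 1 (HPow.incl i Polynomial.X) = HPow.incl i Polynomial.X
      fin_cases i <;> simp [HPow.comul₂, HPow.comul, HPow.inl, HPow.inr]
    rw [PT.comul₂_tmul, e]; rfl
  rw [h]; rfl

/-- The bijection `Fin (m + (n + p)) ≃ Fin (n + m + p)` which interchanges the blocks of lengths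
`m` and `n`. -/
def blockSwap (n m p : ℕ) : Fin (m + (n + p)) ≃ Fin (n + m + p) :=
  (finCongr (Nat.add_assoc m n p).symm).trans
    (finSumFinEquiv.symm.trans
      ((Equiv.sumCongr finAddFlip (Equiv.refl (Fin p))).trans finSumFinEquiv))

/-- The pseudo-Jacobian `J*(A, B, D) = (A * B) * D - A * (B * D) + (σ₁₂ ⊗_H id)(B * (A * D))`
of expanded arguments. Here `σ₁₂` interchanges the two blocks of tensor factors that belong to
`A` and `B`, and the middle term is transported along `n + (m + p) = n + m + p`. -/
def pseudoJacobian [CharZero k] (A : PT k C n) (B : PT k C m) (D : PT k C p) :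
    PT k C (n + m + p) :=
  expandedProd (expandedProd A B) D
    - PT.perm (finCongr (Nat.add_assoc n m p).symm) (expandedProd A (expandedProd B D))
    + PT.perm (blockSwap n m p) (expandedProd B (expandedProd A D))

variable (k C) in
/-- The pseudo-identity in `H^{⊗ 4} ⊗_H C` that expresses the multilinear Mal'cev identity
`-J(a, b, c d) - J(a, b, c) d = a J(c, b, d) + J(a c, b, d)`. Here `σ₂₃` is the transposition of the
second and the third tensor factors (numbered `1` and `2` in `Fin 4`). -/
def MalcevPseudoIdentity [CharZero k] : Prop :=
  ∀ a b c d : C,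
    (-pseudoJacobian (PT.of k a) (PT.of k b) (expandedProd (PT.of k c) (PT.of k d))
      - expandedProd (pseudoJacobian (PT.of k a) (PT.of k b) (PT.of k c)) (PT.of k d) :
        PT k C 4) =
    PT.perm (Equiv.swap (1 : Fin 4) 2)
      (expandedProd (PT.of k a) (pseudoJacobian (PT.of k c) (PT.of k b) (PT.of k d))
        + pseudoJacobian (expandedProd (PT.of k a) (PT.of k c)) (PT.of k b) (PT.of k d))

end Pseudo

/-! ## Varieties of algebras and of conformal algebras -/

section Varieties

/-- The algebra satisfies `a b = -b a`. -/
def IsAnticommutative (A : Type*) [NonUnitalNonAssocRing A] : Prop :=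
  ∀ a b : A, a * b = -(b * a)

/-- `J(a, b, c) = (a b) c - a (b c) + b (a c)`. -/
def jacobian {A : Type*} [NonUnitalNonAssocRing A] (a b c : A) : A :=
  (a * b) * c - a * (b * c) + b * (a * c)

/-- A Mal'cev algebra: anticommutative with `J(a, b, a c) = J(a, b, c) a`. -/
def IsMalcev (A : Type*) [NonUnitalNonAssocRing A] : Prop :=
  IsAnticommutative A ∧ ∀ a b c : A, jacobian a b (a * c) = jacobian a b c * a

variable (k C : Type*) [Field k] [AddCommGroup C] [Module k C] [Module k[X] C]
  [IsScalarTower k k[X] C] [ConformalAlgebra k C]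

/-- A conformal algebra is anticommutative if its coefficient algebra is. -/
def IsAnticommutativeConformal : Prop := IsAnticommutative (Coeff k C)

/-- A conformal algebra is Mal'cev if its coefficient algebra is. -/
def IsMalcevConformal : Prop := IsMalcev (Coeff k C)

end Varieties

end

end Conformal

namespace Conformal

noncomputable section

open Polynomial (aeval)

/-! ## Evaluation of elements of `H^{⊗ n} ⊗_H C` -/

section Eval

variable {k : Type*} [Field k] {n m p : ℕ}

/-! An element of `H^{⊗ n} ⊗_H C` is treated as a family of elements of `Coeff C`. Given Laurent
polynomials `x₁, …, xₙ`, the evaluation `PT.eval x` lets each factor of `f₁ ⊗ ⋯ ⊗ fₙ` act on its own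
`xᵢ`, multiplies the results and uses the product as the argument of `a`. This respects `⊗_H`
because `D` acts on `k[t, t⁻¹]` by a derivation, which matches `Δ⁽ⁿ⁾(D)`.

Two facts carry the theorem. First, evaluation turns expanded pseudoproducts into products in `Coeff
C` (`PT.eval_expandedProd`), since `(-D)ˢ / s!` acts on `tⁿ` exactly as the operator with the
binomial coefficient in the multiplication rule (`aeval_divPow`). Permutations of tensor factors
become permutations of the `xᵢ`. Thus the pseudo-identity evaluates to the multilinear Mal'cev
identity on the elements `a(x)`, which span `Coeff C`.

Second, evaluations separate points (`PT.ext_eval`). Every element is a finite sum of `(D^{i₁} ⊗ ⋯ ⊗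
D^{iₙ} ⊗ 1) ⊗_H cᵢ`. Evaluating at `t^{m₁}, …, t^{mₙ}, t⁻¹` and taking the principal part isolates
`c_m` up to a sign and factorials, which are invertible in characteristic zero. Hence the
pseudo-identity is equivalent to the multilinear identity in `Coeff C`.

What remains is pure algebra: for anticommutative algebras without 2-torsion the multilinear
identity is the linearization of the Mal'cev identity in its repeated variable (`isMalcev_iff`). -/

theorem HPow.induction_on {motive : HPow k n → Prop} (F : HPow k n)
    (smul_tprod : ∀ (r : k) (f : Fin n → k[X]), motive (r • HPow.tprod f))
    (add : ∀ F G, motive F → motive G → motive (F + G)) : motive F :=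
  PiTensorProduct.induction_on (motive := motive) F smul_tprod add

theorem HPow.tprod_mul_tprod (f g : Fin n → k[X]) :
    HPow.tprod f * HPow.tprod g = HPow.tprod (f * g) :=
  PiTensorProduct.tprod_mul_tprod f g

theorem HPow.incl_mul_tprod (i : Fin n) (g : k[X]) (f : Fin n → k[X]) :
    HPow.incl i g * HPow.tprod f = HPow.tprod (Function.update f i (g * f i)) := by
  rw [HPow.incl_eq_tprod, HPow.tprod_mul_tprod]
  congr 1
  ext1 j
  rcases eq_or_ne j i with rfl | h
  · simp
  · simp [h]

/-- The linear map `f₁ ⊗ ⋯ ⊗ fₙ ↦ (f₁ x₁) ⋯ (fₙ xₙ)` from `H^{⊗ n}` to `k[t, t⁻¹]`. -/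
def HPow.eval (x : Fin n → k[T;T⁻¹]) : HPow k n →ₗ[k] k[T;T⁻¹] :=
  PiTensorProduct.lift ((MultilinearMap.mkPiAlgebra k (Fin n) k[T;T⁻¹]).compLinearMap fun i =>
    (LinearMap.applyₗ (x i)).comp (aeval (actD k)).toLinearMap)

@[simp] theorem HPow.eval_tprod (x : Fin n → k[T;T⁻¹]) (f : Fin n → k[X]) :
    HPow.eval x (HPow.tprod f) = ∏ i, aeval (actD k) (f i) (x i) :=
  (PiTensorProduct.lift.tprod _).trans (by simp)

theorem actD_one : actD k 1 = 0 := by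
  rw [← LaurentPolynomial.T_zero, actD_T]; simp

/-- Iterated Leibniz rule, phrased with `Function.update` so that it matches the summands of
`Δ⁽ⁿ⁾(D)` acting on a pure tensor. -/
theorem actD_prod {ι : Type*} [DecidableEq ι] (s : Finset ι) (y : ι → k[T;T⁻¹]) :
    actD k (∏ i ∈ s, y i) = ∑ i ∈ s, ∏ j ∈ s, Function.update y i (actD k (y i)) j := by
  induction s using Finset.induction_on with
  | empty => simp [actD_one]
  | insert a s ha ih =>
    rw [Finset.prod_insert ha, actD_mul, ih, Finset.sum_insert ha, Finset.prod_insert ha,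
      Finset.mul_sum]
    congr 1
    · rw [Function.update_self]
      congr 1
      exact Finset.prod_congr rfl fun j hj =>
        (Function.update_of_ne (ne_of_mem_of_not_mem hj ha) _ _).symm
    · refine Finset.sum_congr rfl fun i hi => ?_
      rw [Finset.prod_insert ha, Function.update_of_ne (ne_of_mem_of_not_mem hi ha).symm]

/-- `D` acts on `H^{⊗ n}` through a sum with one `D` in each place, and the Leibniz rule produces
the same sum. This makes the evaluation descend to `⊗_H`. -/
theorem HPow.eval_X_smul (x : Fin n → k[T;T⁻¹]) (F : HPow k n) :
    HPow.eval x ((Polynomial.X : k[X]) • F) = actD k (HPow.eval x F) := by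
  induction F using HPow.induction_on with
  | add F G hF hG => simp only [smul_add, map_add, hF, hG]
  | smul_tprod r f =>
    rw [smul_comm, LinearMap.map_smul (HPow.eval x) r, LinearMap.map_smul (HPow.eval x) r,
      map_smul (actD k), HPow.smul_eq, HPow.comul, Polynomial.aeval_X,
      Finset.sum_mul, map_sum, HPow.eval_tprod, actD_prod]
    congr 1
    refine Finset.sum_congr rfl fun i _ => ?_
    rw [HPow.incl_mul_tprod, HPow.eval_tprod]
    refine Finset.prod_congr rfl fun j _ => ?_
    rcases eq_or_ne j i with rfl | h
    · simp
    · simp [h]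

/-- The map `HPow.eval` is `H`-linear. -/
theorem HPow.eval_smul (x : Fin n → k[T;T⁻¹]) (f : k[X]) (F : HPow k n) :
    HPow.eval x (f • F) = aeval (actD k) f (HPow.eval x F) := by
  induction f using Polynomial.induction_on generalizing F with
  | C r =>
    rw [← Polynomial.algebraMap_eq, algebraMap_smul, map_smul, AlgHom.commutes,
      Module.algebraMap_end_apply]
  | add p q hp hq => simp only [add_smul, map_add, LinearMap.add_apply, hp, hq]
  | monomial i r ih =>
    rw [pow_succ, ← mul_assoc, mul_smul, ih, HPow.eval_X_smul,
      map_mul (aeval (actD k)) _ Polynomial.X, Polynomial.aeval_X, Module.End.mul_apply]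

theorem HPow.eval_tmul (x : Fin n → k[T;T⁻¹]) (y : Fin m → k[T;T⁻¹]) (F : HPow k n)
    (G : HPow k m) :
    HPow.eval (Fin.append x y) (HPow.tmul F G) = HPow.eval x F * HPow.eval y G := by
  induction F using HPow.induction_on with
  | add F F' hF hF' =>
    rw [HPow.tmul] at hF hF' ⊢
    simp only [map_add, add_mul, hF, hF']
  | smul_tprod r f =>
    induction G using HPow.induction_on with
    | add G G' hG hG' =>
      rw [HPow.tmul] at hG hG' ⊢
      simp only [map_add, mul_add, hG, hG']
    | smul_tprod s g =>
      have h : HPow.tmul (r • HPow.tprod f) (s • HPow.tprod g) =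
          r • s • HPow.tmul (HPow.tprod f) (HPow.tprod g) := by
        simp only [HPow.tmul, map_smul, smul_mul_assoc, mul_smul_comm]
        rw [smul_comm]
      rw [h, HPow.tmul_tprod]
      simp only [map_smul, HPow.eval_tprod, Fin.prod_univ_add, Fin.append_left, Fin.append_right,
        smul_mul_assoc, mul_smul_comm]
      rw [smul_comm]

theorem HPow.tmul_mul_tmul (F F' : HPow k n) (G G' : HPow k m) :
    HPow.tmul F G * HPow.tmul F' G' = HPow.tmul (F * F') (G * G') := by
  simp only [HPow.tmul, map_mul]
  ring

/-- Commutativity of `k[t, t⁻¹]` lets a permutation of the factors be absorbed into a relabelling of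
the arguments. -/
theorem HPow.eval_perm (e : Fin n ≃ Fin m) (x : Fin m → k[T;T⁻¹]) (F : HPow k n) :
    HPow.eval x (HPow.perm e F) = HPow.eval (x ∘ e) F := by
  induction F using HPow.induction_on with
  | add F G hF hG => simp only [map_add, hF, hG]
  | smul_tprod r f =>
    rw [← algebraMap_smul k[X] r, map_smul, algebraMap_smul, algebraMap_smul, map_smul, map_smul,
      HPow.perm_tprod, HPow.eval_tprod, HPow.eval_tprod, ← e.prod_comp]
    simp

/-- Both families of operators start at the identity and satisfy `(s + 1) u_{s+1} = -D u_s`, which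
determines them in characteristic zero. This is where the coefficients of the pseudoproduct meet
those of the coefficient algebra. -/
theorem aeval_divPow [CharZero k] (s : ℕ) (x : k[T;T⁻¹]) :
    aeval (actD k) (divPow k s) x = hasse k s x := by
  induction s with
  | zero =>
    have h : hasse k 0 = LinearMap.id := laurent_ext k fun n => by simp
    simp [divPow, h]
  | succ s ih =>
    have h := congrArg (fun f => aeval (actD k) f x) (divPow_succ (k := k) s)
    simp only [map_nsmul, map_neg, map_mul, Polynomial.aeval_X, LinearMap.smul_apply,
      LinearMap.neg_apply, Module.End.mul_apply, ih, actD_hasse, neg_neg] at h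
    rw [← Nat.cast_smul_eq_nsmul k, ← Nat.cast_smul_eq_nsmul k] at h
    exact smul_right_injective _ (Nat.cast_ne_zero.mpr s.succ_ne_zero) h

/-! ### Evaluation with values in the coefficient space. -/

section Space

variable {C : Type*} [AddCommGroup C] [Module k[X] C]

theorem Coeff.mk_aeval [Module k C] [IsScalarTower k k[X] C] (f : k[X]) (x : k[T;T⁻¹]) (a : C) :
    Coeff.mk k (aeval (actD k) f x) a = Coeff.mk k x (f • a) := by
  induction f using Polynomial.induction_on generalizing x a with
  | C r =>
    rw [← Polynomial.algebraMap_eq, algebraMap_smul, AlgHom.commutes,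
      Module.algebraMap_end_apply, Coeff.mk_smul]
  | add p q hp hq =>
    simp only [add_smul, map_add, LinearMap.add_apply, AddMonoidHom.add_apply, hp, hq]
  | monomial i r ih =>
    rw [pow_succ, ← mul_assoc, map_mul (aeval (actD k)) _ Polynomial.X, Module.End.mul_apply, ih,
      Polynomial.aeval_X, Coeff.mk_actD, smul_smul, mul_comm]

variable [Module k C] [IsScalarTower k k[X] C]

/-- The evaluation `(f₁ ⊗ ⋯ ⊗ fₙ) ⊗_H a ↦ a((f₁ x₁) ⋯ (fₙ xₙ))`. -/
def PT.eval (x : Fin n → k[T;T⁻¹]) : PT k C n →+ Coeff k C :=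
  TensorProduct.liftAddHom ((Coeff.mk k).comp (HPow.eval x).toAddMonoidHom) fun f F a => by
    change Coeff.mk k (HPow.eval x (f • F)) a = Coeff.mk k (HPow.eval x F) (f • a)
    rw [HPow.eval_smul, Coeff.mk_aeval]

@[simp] theorem PT.eval_tmul (x : Fin n → k[T;T⁻¹]) (F : HPow k n) (a : C) :
    PT.eval x (F ⊗ₜ[k[X]] a) = Coeff.mk k (HPow.eval x F) a := rfl

theorem PT.eval_of (x : Fin 1 → k[T;T⁻¹]) (a : C) : PT.eval x (PT.of k a) = Coeff.mk k (x 0) a := by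
  have h : (1 : HPow k 1) = HPow.tprod 1 := rfl
  rw [PT.of, PT.eval_tmul, h, HPow.eval_tprod]
  simp

theorem PT.eval_perm (e : Fin n ≃ Fin m) (x : Fin m → k[T;T⁻¹]) (A : PT k C n) :
    PT.eval x (PT.perm e A) = PT.eval (x ∘ e) A := by
  induction A using TensorProduct.induction_on with
  | zero => simp
  | tmul F a => rw [PT.perm_tmul, PT.eval_tmul, PT.eval_tmul, HPow.eval_perm]
  | add u v hu hv => simp only [map_add, hu, hv]

end Space

/-! ### Evaluation turns pseudoproducts into products. -/

section Product

variable [CharZero k] {C : Type*} [AddCommGroup C] [Module k C] [Module k[X] C]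
  [IsScalarTower k k[X] C] [ConformalAlgebra k C]

/-- By biadditivity pure tensors suffice, and there the two sums over `s` agree term by term: the
factor `(-D)ˢ / s! ⊗ 1` reaches only the block of `A`, where it becomes `hasse k s` applied to the
evaluation of `F`. -/
theorem PT.eval_expandedProd (x : Fin n → k[T;T⁻¹]) (y : Fin m → k[T;T⁻¹]) (A : PT k C n)
    (B : PT k C m) :
    PT.eval (Fin.append x y) (expandedProd A B) = PT.eval x A * PT.eval y B := by
  induction A using TensorProduct.induction_on with
  | zero => simp
  | add u v hu hv => simp only [map_add, AddMonoidHom.add_apply, hu, hv, add_mul]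
  | tmul F a =>
    induction B using TensorProduct.induction_on with
    | zero => simp
    | add u v hu hv => simp only [map_add, hu, hv, mul_add]
    | tmul G b =>
      rw [expandedProd_tmul, PT.eval_tmul, PT.eval_tmul, Coeff.mk_mul_mk]
      refine Eq.trans (locSum_comp k ((PT.eval (Fin.append x y)).comp
        ((DistribSMul.toAddMonoidHom (PT k C (n + m)) (HPow.tmul F G)).comp
          (PT.comul₂ n m))) _ a b) ?_
      congr 1
      ext s c
      simp only [AddMonoidHom.comp_apply, LinearMap.toAddMonoidHom_coe, TensorProduct.mk_apply,
        DistribSMul.toAddMonoidHom_apply, PT.comul₂_tmul, TensorProduct.smul_tmul', smul_eq_mul,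
        PT.eval_tmul, HPow.comul₂_tprod, HPow.tmul_mul_tmul, map_one, mul_one, HPow.eval_tmul]
      -- The product `F Δ⁽ⁿ⁾(f)` is the `H`-action of `f` on `F`, so `H`-linearity of the evaluation
      -- applies.
      rw [mul_comm F, ← HPow.smul_eq, HPow.eval_smul, aeval_divPow]

/-- `blockSwap` sends the block order `B, A, E` to `A, B, E`, so pulling arguments back along it
exchanges the first two blocks, as the last term of the Jacobian requires. -/
theorem append_comp_blockSwap {α : Type*} (x : Fin n → α) (y : Fin m → α) (z : Fin p → α) :
    Fin.append (Fin.append x y) z ∘ blockSwap n m p = Fin.append y (Fin.append x z) := by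
  ext i
  refine Fin.addCases (fun i => ?_) (fun i => ?_) i
  · have h : blockSwap n m p (Fin.castAdd (n + p) i) = Fin.castAdd p (Fin.natAdd n i) := by
      have e : (finCongr (Nat.add_assoc m n p).symm) (Fin.castAdd (n + p) i) =
          Fin.castAdd p (Fin.castAdd n i) := by ext; simp
      simp only [blockSwap, Equiv.trans_apply, e]
      simp
    simp [h]
  · refine Fin.addCases (fun i => ?_) (fun i => ?_) i
    · have h : blockSwap n m p (Fin.natAdd m (Fin.castAdd p i)) =
          Fin.castAdd p (Fin.castAdd m i) := by
        have e : (finCongr (Nat.add_assoc m n p).symm) (Fin.natAdd m (Fin.castAdd p i)) =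
            Fin.castAdd p (Fin.natAdd m i) := by ext; simp
        simp only [blockSwap, Equiv.trans_apply, e]
        simp
      simp [h]
    · have h : blockSwap n m p (Fin.natAdd m (Fin.natAdd n i)) = Fin.natAdd (n + m) i := by
        have e : (finCongr (Nat.add_assoc m n p).symm) (Fin.natAdd m (Fin.natAdd n i)) =
            Fin.natAdd (m + n) i := by ext; simp [add_assoc]
        simp only [blockSwap, Equiv.trans_apply, e]
        simp
      simp [h]

theorem PT.eval_pseudoJacobian (x : Fin n → k[T;T⁻¹]) (y : Fin m → k[T;T⁻¹])
    (z : Fin p → k[T;T⁻¹]) (A : PT k C n) (B : PT k C m) (E : PT k C p) :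
    PT.eval (Fin.append (Fin.append x y) z) (pseudoJacobian A B E) =
      jacobian (PT.eval x A) (PT.eval y B) (PT.eval z E) := by
  have h : Fin.append (Fin.append x y) z ∘ finCongr (Nat.add_assoc n m p).symm =
      Fin.append x (Fin.append y z) := by
    rw [Fin.append_assoc]
    ext i
    simp
  simp only [pseudoJacobian, jacobian, map_add, map_sub, PT.eval_perm, h, append_comp_blockSwap,
    PT.eval_expandedProd]

end Product

end Eval

/-! ## Evaluations separate the elements of `H^{⊗ n} ⊗_H C` -/

section Separation

variable {k : Type*} [Field k] {n : ℕ}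

/-- The falling factorial vanishes once `i > m`: differentiating a nonnegative power never produces
a negative one. The separation argument rests on this. -/
theorem actD_pow_T (m i : ℕ) :
    (actD k ^ i) (LaurentPolynomial.T (m : ℤ)) =
      ((-1) ^ i * (m.descFactorial i : k)) • LaurentPolynomial.T ((m : ℤ) - i) := by
  induction i with
  | zero => simp
  | succ i ih =>
    rw [pow_succ', Module.End.mul_apply, ih, map_smul, actD_T, smul_neg, smul_smul, ← neg_smul,
      Nat.descFactorial_succ]
    congr 1
    -- The factor `m - i` in `Nat.descFactorial_succ` is truncated subtraction; it is the true
    -- difference when `i ≤ m`, and otherwise the other factor is already zero.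
    · rcases le_or_gt i m with h | h
      · push_cast [h]
        ring
      · simp [Nat.descFactorial_eq_zero_iff_lt.mpr h]
    · push_cast
      rw [sub_sub]

theorem prod_T {ι : Type*} (s : Finset ι) (f : ι → ℤ) :
    ∏ i ∈ s, (LaurentPolynomial.T (f i) : k[T;T⁻¹]) = LaurentPolynomial.T (∑ i ∈ s, f i) := by
  classical
  induction s using Finset.induction_on with
  | empty => simp
  | insert a s ha ih =>
    rw [Finset.prod_insert ha, Finset.sum_insert ha, ih, LaurentPolynomial.T_add]

variable (k) in
/-- The monomial `D^{i₁} ⊗ ⋯ ⊗ D^{iₙ} ⊗ 1` in `H^{⊗ (n + 1)}`. -/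
def HPow.monomial (i : Fin n → ℕ) : HPow k (n + 1) :=
  HPow.tprod (Fin.snoc (fun j => (Polynomial.X : k[X]) ^ i j) 1 : Fin (n + 1) → k[X])

theorem HPow.monomial_zero : HPow.monomial k (0 : Fin n → ℕ) = 1 := by
  have h : (1 : HPow k (n + 1)) = HPow.tprod 1 := rfl
  rw [h, HPow.monomial]
  congr 1
  ext1 j
  refine Fin.lastCases ?_ (fun j => ?_) j <;> simp

theorem HPow.incl_X_mul_monomial (j : Fin n) (i : Fin n → ℕ) :
    HPow.incl j.castSucc Polynomial.X * HPow.monomial k i =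
      HPow.monomial k (Function.update i j (i j + 1)) := by
  rw [HPow.monomial, HPow.monomial, HPow.incl_mul_tprod]
  congr 1
  ext1 l
  refine Fin.lastCases ?_ (fun l => ?_) l
  · rw [Function.update_of_ne (Fin.castSucc_lt_last j).ne']
    simp
  · rcases eq_or_ne l j with rfl | h
    · simp [pow_succ']
    · rw [Function.update_of_ne (by simpa using h)]
      simp [h]

/-- The last argument `t⁻¹` meets the factor `1` and only lowers the exponent by one. The exponent
is therefore exactly `-1` for `i = m`, and at least `0` for every other `i ≤ m`. -/
theorem HPow.eval_monomial (m i : Fin n → ℕ) :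
    HPow.eval (Fin.snoc (fun j => LaurentPolynomial.T (m j : ℤ)) (LaurentPolynomial.T (-1)) :
        Fin (n + 1) → k[T;T⁻¹]) (HPow.monomial k i) =
      (∏ j, (-1) ^ i j * ((m j).descFactorial (i j) : k)) •
        LaurentPolynomial.T (∑ j, ((m j : ℤ) - i j) - 1) := by
  rw [HPow.monomial, HPow.eval_tprod, Fin.prod_univ_castSucc]
  simp only [Fin.snoc_castSucc, Fin.snoc_last, map_pow, Polynomial.aeval_X, actD_pow_T, map_one,
    Module.End.one_apply, Finset.prod_smul, prod_T, smul_mul_assoc, ← LaurentPolynomial.T_add,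
    sub_eq_add_neg]

/-! ### Normal forms in `H^{⊗ (n + 1)} ⊗_H C`, and extraction of their coefficients. -/

variable {C : Type*} [AddCommGroup C] [Module k[X] C]

/-- The map `∑ᵢ cᵢ ↦ ∑ᵢ (D^{i₁} ⊗ ⋯ ⊗ D^{iₙ} ⊗ 1) ⊗_H cᵢ`. -/
def PT.ofFinsupp : ((Fin n → ℕ) →₀ C) →+ PT k C (n + 1) :=
  Finsupp.liftAddHom fun i =>
    (TensorProduct.mk k[X] (HPow k (n + 1)) C (HPow.monomial k i)).toAddMonoidHom

theorem PT.ofFinsupp_single (i : Fin n → ℕ) (c : C) :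
    PT.ofFinsupp (Finsupp.single i c) = HPow.monomial k i ⊗ₜ[k[X]] c := by
  simp [PT.ofFinsupp]

theorem PT.monomial_tmul_mem_range (i : Fin n → ℕ) (c : C) :
    HPow.monomial k i ⊗ₜ[k[X]] c ∈ (PT.ofFinsupp (k := k) (C := C) (n := n)).range :=
  ⟨Finsupp.single i c, PT.ofFinsupp_single i c⟩

theorem PT.smul_mem_range_of_monomial {F : HPow k (n + 1)}
    (h : ∀ i (c : C), (F * HPow.monomial k i) ⊗ₜ[k[X]] c ∈
      (PT.ofFinsupp (k := k) (C := C) (n := n)).range)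
    {z : PT k C (n + 1)} (hz : z ∈ (PT.ofFinsupp (k := k) (C := C) (n := n)).range) :
    F • z ∈ (PT.ofFinsupp (k := k) (C := C) (n := n)).range := by
  obtain ⟨c, rfl⟩ := hz
  induction c using Finsupp.induction_linear with
  | zero => simp
  | add f g hf hg => rw [map_add, smul_add]; exact add_mem hf hg
  | single i c =>
    rw [PT.ofFinsupp_single, TensorProduct.smul_tmul', smul_eq_mul]
    exact h i c

/-- A `D` in one of the first `n` places raises an exponent. A `D` in the last place equals `Δ(D)`
minus the `D` in all other places, and `Δ(D)` passes through `⊗_H` to act on the coefficient in `C`.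
-/
theorem PT.incl_X_smul_mem_range (j : Fin (n + 1)) {z : PT k C (n + 1)}
    (hz : z ∈ (PT.ofFinsupp (k := k) (C := C) (n := n)).range) :
    (HPow.incl j Polynomial.X : HPow k (n + 1)) • z ∈
      (PT.ofFinsupp (k := k) (C := C) (n := n)).range := by
  refine PT.smul_mem_range_of_monomial (fun i c => ?_) hz
  refine Fin.lastCases ?_ (fun j => ?_) j
  · have e : (HPow.incl (Fin.last n) Polynomial.X : HPow k (n + 1)) * HPow.monomial k i =
        (Polynomial.X : k[X]) • HPow.monomial k i -
          ∑ j : Fin n, HPow.monomial k (Function.update i j (i j + 1)) := by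
      rw [HPow.smul_eq, HPow.comul, Polynomial.aeval_X, Fin.sum_univ_castSucc, add_mul,
        Finset.sum_mul]
      simp only [HPow.incl_X_mul_monomial]
      abel
    rw [e, TensorProduct.sub_tmul, TensorProduct.smul_tmul, TensorProduct.sum_tmul]
    exact sub_mem (PT.monomial_tmul_mem_range _ _)
      (sum_mem fun j _ => PT.monomial_tmul_mem_range _ _)
  · rw [HPow.incl_X_mul_monomial]
    exact PT.monomial_tmul_mem_range _ _

theorem PT.algebraMap_smul_mem_range (r : k) {z : PT k C (n + 1)}
    (hz : z ∈ (PT.ofFinsupp (k := k) (C := C) (n := n)).range) :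
    algebraMap k (HPow k (n + 1)) r • z ∈
      (PT.ofFinsupp (k := k) (C := C) (n := n)).range := by
  refine PT.smul_mem_range_of_monomial (fun i c => ?_) hz
  rw [← Algebra.smul_def, ← algebraMap_smul k[X] r, TensorProduct.smul_tmul]
  exact PT.monomial_tmul_mem_range _ _

theorem PT.incl_smul_mem_range (j : Fin (n + 1)) (f : k[X]) {z : PT k C (n + 1)}
    (hz : z ∈ (PT.ofFinsupp (k := k) (C := C) (n := n)).range) :
    (HPow.incl j f : HPow k (n + 1)) • z ∈
      (PT.ofFinsupp (k := k) (C := C) (n := n)).range := by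
  induction f using Polynomial.induction_on generalizing z with
  | C r =>
    rw [← Polynomial.algebraMap_eq, AlgHom.commutes]
    exact PT.algebraMap_smul_mem_range r hz
  | add p q hp hq => rw [map_add, add_smul]; exact add_mem (hp hz) (hq hz)
  | monomial i r ih =>
    rw [pow_succ, ← mul_assoc, map_mul, mul_smul]
    exact ih (PT.incl_X_smul_mem_range j hz)

theorem PT.prod_incl_smul_mem_range (s : Finset (Fin (n + 1))) (f : Fin (n + 1) → k[X])
    {z : PT k C (n + 1)} (hz : z ∈ (PT.ofFinsupp (k := k) (C := C) (n := n)).range) :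
    (∏ j ∈ s, HPow.incl j (f j) : HPow k (n + 1)) • z ∈
      (PT.ofFinsupp (k := k) (C := C) (n := n)).range := by
  induction s using Finset.induction_on with
  | empty => simpa using hz
  | insert a s ha ih =>
    rw [Finset.prod_insert ha, mul_smul]
    exact PT.incl_smul_mem_range a _ ih

/-- The range contains `1 ⊗_H a` and is stable under multiplication by polynomials in each tensor
place and by scalars; these generate every pure tensor. -/
theorem PT.ofFinsupp_surjective :
    Function.Surjective (PT.ofFinsupp (k := k) (C := C) (n := n)) := by
  intro z
  change z ∈ (PT.ofFinsupp (k := k) (C := C) (n := n)).range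
  induction z using TensorProduct.induction_on with
  | zero => exact zero_mem _
  | add u v hu hv => exact add_mem hu hv
  | tmul F a =>
    induction F using HPow.induction_on with
    | add F G hF hG => rw [TensorProduct.add_tmul]; exact add_mem hF hG
    | smul_tprod r f =>
      have h := PT.algebraMap_smul_mem_range r (PT.prod_incl_smul_mem_range Finset.univ f
        (PT.monomial_tmul_mem_range (0 : Fin n → ℕ) a))
      rwa [HPow.monomial_zero, HPow.prod_incl, TensorProduct.smul_tmul', smul_eq_mul, mul_one,
        TensorProduct.smul_tmul', smul_eq_mul, ← Algebra.smul_def] at h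

/-- The linear map with `tⁿ ↦ 0` for `n ≥ 0` and `t^{-1-j} ↦ Dʲ / j!`. -/
def principalPart : k[T;T⁻¹] →ₗ[k] k[X] :=
  (Finsupp.lsum k fun n : ℤ => LinearMap.toSpanSingleton k k[X]
    (Int.casesOn n (fun _ => 0) fun j => ((j.factorial : k)⁻¹) • Polynomial.X ^ j)) ∘ₗ
  (AddMonoidAlgebra.coeffLinearEquiv k).toLinearMap

theorem principalPart_T (n : ℤ) :
    principalPart (k := k) (LaurentPolynomial.T n) =
      Int.casesOn n (fun _ => 0) fun j => ((j.factorial : k)⁻¹) • Polynomial.X ^ j := by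
  rw [principalPart, LinearMap.comp_apply]
  refine (Finsupp.sum_single_index ?_).trans ?_ <;> simp

@[simp] theorem principalPart_T_natCast (n : ℕ) :
    principalPart (k := k) (LaurentPolynomial.T (n : ℤ)) = 0 :=
  principalPart_T _

@[simp] theorem principalPart_T_negSucc (j : ℕ) :
    principalPart (k := k) (LaurentPolynomial.T (Int.negSucc j)) =
      ((j.factorial : k)⁻¹) • Polynomial.X ^ j :=
  principalPart_T _

/-- If some `iⱼ > mⱼ`, the falling factorial kills the term. Otherwise some `iⱼ < mⱼ`, so the
resulting exponent is nonnegative and the principal part vanishes. -/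
theorem principalPart_eval_monomial_of_ne {m i : Fin n → ℕ} (h : i ≠ m) :
    principalPart (HPow.eval (Fin.snoc (fun j => LaurentPolynomial.T (m j : ℤ))
      (LaurentPolynomial.T (-1)) : Fin (n + 1) → k[T;T⁻¹]) (HPow.monomial k i)) = 0 := by
  rw [HPow.eval_monomial, map_smul]
  by_cases hle : ∀ j, i j ≤ m j
  · obtain ⟨j, hj⟩ := Function.ne_iff.mp h
    have hpos : 0 < ∑ j, ((m j : ℤ) - i j) :=
      Finset.sum_pos' (fun l _ => by have := hle l; omega)
        ⟨j, Finset.mem_univ j, by have := hle j; omega⟩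
    obtain ⟨N, hN⟩ := Int.eq_ofNat_of_zero_le (Int.le_sub_one_of_lt hpos)
    rw [hN, principalPart_T_natCast, smul_zero]
  · push Not at hle
    obtain ⟨j, hj⟩ := hle
    rw [Finset.prod_eq_zero (Finset.mem_univ j), zero_smul]
    rw [Nat.descFactorial_eq_zero_iff_lt.mpr hj, Nat.cast_zero, mul_zero]

theorem principalPart_eval_monomial_self (m : Fin n → ℕ) :
    principalPart (HPow.eval (Fin.snoc (fun j => LaurentPolynomial.T (m j : ℤ))
      (LaurentPolynomial.T (-1)) : Fin (n + 1) → k[T;T⁻¹]) (HPow.monomial k m)) =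
      Polynomial.C (∏ j, (-1) ^ m j * ((m j).factorial : k)) := by
  rw [HPow.eval_monomial, map_smul]
  simp only [sub_self, Finset.sum_const_zero, zero_sub, Nat.descFactorial_self]
  rw [show (-1 : ℤ) = Int.negSucc 0 from rfl, principalPart_T_negSucc, Nat.factorial_zero,
    Nat.cast_one, inv_one, one_smul, pow_zero, Polynomial.smul_eq_C_mul, mul_one]

variable [CharZero k]

/-- On `t^{-1-j}` this is `(j + 1) / (j + 1)! = 1 / j!`. Nonnegative powers cannot leak into the
principal part, because the derivative of `t⁰` carries the coefficient zero. This compatibility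
makes the principal part well defined on `Coeff C`. -/
theorem principalPart_actD (x : k[T;T⁻¹]) :
    principalPart (actD k x) = Polynomial.X * principalPart x := by
  suffices h : principalPart ∘ₗ actD k = LinearMap.mulLeft k Polynomial.X ∘ₗ principalPart from
    LinearMap.congr_fun h x
  refine laurent_ext k fun n => ?_
  rw [LinearMap.comp_apply, LinearMap.comp_apply, LinearMap.mulLeft_apply, actD_T, map_neg, map_smul]
  cases n with
  | ofNat n =>
    cases n with
    | zero =>
      rw [Int.ofNat_eq_natCast, principalPart_T_natCast, Nat.cast_zero, Int.cast_zero, zero_smul,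
        neg_zero, mul_zero]
    | succ n =>
      rw [Int.ofNat_eq_natCast, principalPart_T_natCast, Nat.cast_succ, add_sub_cancel_right,
        principalPart_T_natCast, smul_zero, neg_zero, mul_zero]
  | negSucc j =>
    rw [show Int.negSucc j - 1 = Int.negSucc (j + 1) from rfl, principalPart_T_negSucc,
      principalPart_T_negSucc, mul_smul_comm, smul_smul, ← neg_smul, pow_succ' _ j]
    congr 1
    have h : ((j : k) + 1) ≠ 0 := by exact_mod_cast j.succ_ne_zero
    have h' : (j.factorial : k) ≠ 0 := by exact_mod_cast j.factorial_ne_zero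
    rw [Nat.factorial_succ, Int.cast_negSucc]
    push_cast
    field_simp

/-- The map `Coeff C → C` with `a(n) ↦ 0` for `n ≥ 0` and `a(-1 - j) ↦ Dʲ a / j!`. -/
def Coeff.principalPart : Coeff k C →+ C :=
  Coeff.lift k
    (biadd (fun x a => Conformal.principalPart x • a)
      (fun x y a => by rw [map_add, add_smul])
      (fun x a b => smul_add _ _ _))
    (fun r x a => by
      rw [biadd_apply, biadd_apply, map_smul, smul_smul, Polynomial.smul_eq_C_mul, mul_comm])
    (fun x a => by
      rw [biadd_apply, biadd_apply, principalPart_actD, smul_smul, mul_comm])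

@[simp] theorem Coeff.principalPart_mk (x : k[T;T⁻¹]) (a : C) :
    Coeff.principalPart (Coeff.mk k x a) = Conformal.principalPart x • a :=
  Coeff.lift_mk k _ _ _ x a

variable [Module k C] [IsScalarTower k k[X] C]

/-- One test tuple for each `m` picks out a single coefficient. Consequently the normal form is
unique whenever the factorials are invertible. -/
theorem PT.principalPart_eval_ofFinsupp (m : Fin n → ℕ) (c : (Fin n → ℕ) →₀ C) :
    Coeff.principalPart (PT.eval (Fin.snoc (fun j => LaurentPolynomial.T (m j : ℤ))
      (LaurentPolynomial.T (-1)) : Fin (n + 1) → k[T;T⁻¹]) (PT.ofFinsupp c)) =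
      (∏ j, (-1) ^ m j * ((m j).factorial : k)) • c m := by
  induction c using Finsupp.induction_linear with
  | zero => simp
  | add f g hf hg => simp only [map_add, hf, hg, Finsupp.add_apply, smul_add]
  | single i a =>
    rw [PT.ofFinsupp_single, PT.eval_tmul, Coeff.principalPart_mk]
    rcases eq_or_ne i m with rfl | h
    · rw [principalPart_eval_monomial_self, Finsupp.single_eq_same, ← Polynomial.algebraMap_eq,
        algebraMap_smul]
    · rw [principalPart_eval_monomial_of_ne h, zero_smul, Finsupp.single_eq_of_ne h.symm, smul_zero]

/-- An element of `H^{⊗ (n + 1)} ⊗_H C` is determined by its evaluations. -/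
theorem PT.ext_eval {z w : PT k C (n + 1)}
    (h : ∀ x : Fin (n + 1) → k[T;T⁻¹], PT.eval x z = PT.eval x w) : z = w := by
  obtain ⟨c, rfl⟩ := PT.ofFinsupp_surjective z
  obtain ⟨d, rfl⟩ := PT.ofFinsupp_surjective w
  congr 1
  ext m
  -- Equal evaluations give equal `m`-th coefficients up to the common scalar `∏ (-1)^{mⱼ} mⱼ!`,
  -- which is nonzero in characteristic zero.
  have hm := congrArg Coeff.principalPart
    (h (Fin.snoc (fun j => LaurentPolynomial.T (m j : ℤ)) (LaurentPolynomial.T (-1))))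
  rw [PT.principalPart_eval_ofFinsupp, PT.principalPart_eval_ofFinsupp] at hm
  refine smul_right_injective C (Finset.prod_ne_zero_iff.mpr fun j _ => ?_) hm
  exact mul_ne_zero (pow_ne_zero _ (by simp)) (by exact_mod_cast (m j).factorial_ne_zero)

end Separation

/-! ## The multilinear form of the Mal'cev identity -/

section Malcev

/-- In an anticommutative algebra without 2-torsion the Mal'cev identity is equivalent to its
linearization. -/
theorem isMalcev_iff {A : Type*} [NonUnitalNonAssocRing A] (hA : IsAnticommutative A)
    (h2 : ∀ a : A, a + a = 0 → a = 0) :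
    IsMalcev A ↔ ∀ a b c d : A, -jacobian a b (c * d) - jacobian a b c * d =
      a * jacobian c b d + jacobian (a * c) b d := by
  -- Anticommutativity makes the Jacobian skew in its outer arguments; this is the only symmetry
  -- needed in both directions.
  have swap : ∀ a b c : A, jacobian c b a = -jacobian a b c := fun a b c => by
    simp only [jacobian]
    rw [hA (c * b) a, hA c b, hA c (b * a), hA b a, hA b (c * a), hA c a]
    simp only [neg_mul, mul_neg, neg_neg]
    rw [hA (a * c) b]
    abel
  have add₁ : ∀ a a' b c : A, jacobian (a + a') b c = jacobian a b c + jacobian a' b c :=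
    fun a a' b c => by simp only [jacobian, add_mul, mul_add]; abel
  have add₃ : ∀ a b c c' : A, jacobian a b (c + c') = jacobian a b c + jacobian a b c' :=
    fun a b c c' => by simp only [jacobian, mul_add]; abel
  have neg₃ : ∀ a b c : A, jacobian a b (-c) = -jacobian a b c :=
    fun a b c => by simp only [jacobian, mul_neg]; abel
  constructor
  · rintro ⟨-, h⟩ a b c d
    -- Linearization: replace the repeated variable by `a + d` and remove the instances for `a` and
    -- `d`. The cross terms, reordered by `swap` and anticommutativity, form the multilinear
    -- identity.
    have e := h (a + d) b c
    rw [add_mul, add₃, add₁, add₁, add₁, mul_add, add_mul, add_mul, h a b c, h d b c,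
      hA d c, neg₃, swap (a * c) b d, swap c b d, neg_mul, neg_mul, ← hA a (jacobian c b d)] at e
    have e' : -jacobian a b (c * d) - jacobian a b c * d -
        (a * jacobian c b d + jacobian (a * c) b d) = 0 := by
      rw [← sub_eq_zero] at e
      rw [← e]
      abel
    exact sub_eq_zero.mp e'
  · refine fun h => ⟨hA, fun a b c => ?_⟩
    -- Setting `d = a` collapses the linearization to twice the Mal'cev identity, so the absence of
    -- 2-torsion finishes.
    have e := h a b c a
    rw [hA c a, neg₃, swap a b c, swap a b (a * c), mul_neg,
      ← hA (jacobian a b c) a, neg_neg] at e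
    refine sub_eq_zero.mp (h2 _ ?_)
    rw [← sub_eq_zero] at e
    rw [← e]
    abel

end Malcev

/-! ### The pseudo-identity and the multilinear identity in the coefficient algebra. -/

section Main

variable {k : Type*} [Field k] [CharZero k] {C : Type*} [AddCommGroup C] [Module k C]
  [Module k[X] C] [IsScalarTower k k[X] C] [ConformalAlgebra k C]

/-- The two sides of the Mal'cev pseudo-identity evaluate to the two sides of the multilinear
Mal'cev identity in the coefficient algebra. -/
theorem malcevPseudoIdentity_iff_mk :
    MalcevPseudoIdentity k C ↔ ∀ (a b c d : C) (x : Fin 4 → k[T;T⁻¹]),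
      -jacobian (Coeff.mk k (x 0) a) (Coeff.mk k (x 1) b)
          (Coeff.mk k (x 2) c * Coeff.mk k (x 3) d)
        - jacobian (Coeff.mk k (x 0) a) (Coeff.mk k (x 1) b) (Coeff.mk k (x 2) c)
          * Coeff.mk k (x 3) d =
      Coeff.mk k (x 0) a * jacobian (Coeff.mk k (x 2) c) (Coeff.mk k (x 1) b)
          (Coeff.mk k (x 3) d)
        + jacobian (Coeff.mk k (x 0) a * Coeff.mk k (x 2) c) (Coeff.mk k (x 1) b)
          (Coeff.mk k (x 3) d) := by
  have h₁ : ∀ (a b c d : C) (x : Fin 4 → k[T;T⁻¹]), PT.eval x (pseudoJacobian (PT.of k a)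
      (PT.of k b) (expandedProd (PT.of k c) (PT.of k d)) : PT k C 4) =
        jacobian (Coeff.mk k (x 0) a) (Coeff.mk k (x 1) b)
          (Coeff.mk k (x 2) c * Coeff.mk k (x 3) d) := fun a b c d x => by
    -- The four arguments are bracketed like the arguments of the expression being evaluated, so
    -- that the evaluation rules for products and Jacobians apply.
    have e : x = Fin.append (Fin.append ![x 0] ![x 1]) (Fin.append ![x 2] ![x 3]) := by
      ext1 i; fin_cases i <;> rfl
    rw [e]
    refine (PT.eval_pseudoJacobian ..).trans ?_
    rw [PT.eval_expandedProd]
    simp only [PT.eval_of]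
    rfl
  have h₂ : ∀ (a b c d : C) (x : Fin 4 → k[T;T⁻¹]), PT.eval x (expandedProd (pseudoJacobian
      (PT.of k a) (PT.of k b) (PT.of k c)) (PT.of k d) : PT k C 4) =
        jacobian (Coeff.mk k (x 0) a) (Coeff.mk k (x 1) b) (Coeff.mk k (x 2) c)
          * Coeff.mk k (x 3) d := fun a b c d x => by
    have e : x = Fin.append (Fin.append (Fin.append ![x 0] ![x 1]) ![x 2]) ![x 3] := by
      ext1 i; fin_cases i <;> rfl
    rw [e]
    refine (PT.eval_expandedProd ..).trans ?_
    rw [PT.eval_pseudoJacobian]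
    simp only [PT.eval_of]
    rfl
  have h₃ : ∀ (a b c d : C) (x : Fin 4 → k[T;T⁻¹]), PT.eval x (expandedProd (PT.of k a)
      (pseudoJacobian (PT.of k b) (PT.of k c) (PT.of k d)) : PT k C 4) =
        Coeff.mk k (x 0) a * jacobian (Coeff.mk k (x 1) b) (Coeff.mk k (x 2) c)
          (Coeff.mk k (x 3) d) := fun a b c d x => by
    have e : x = Fin.append ![x 0] (Fin.append (Fin.append ![x 1] ![x 2]) ![x 3]) := by
      ext1 i; fin_cases i <;> rfl
    rw [e]
    refine (PT.eval_expandedProd ..).trans ?_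
    rw [PT.eval_pseudoJacobian]
    simp only [PT.eval_of]
    rfl
  have h₄ : ∀ (a b c d : C) (x : Fin 4 → k[T;T⁻¹]), PT.eval x (pseudoJacobian
      (expandedProd (PT.of k a) (PT.of k b)) (PT.of k c) (PT.of k d) : PT k C 4) =
        jacobian (Coeff.mk k (x 0) a * Coeff.mk k (x 1) b) (Coeff.mk k (x 2) c)
          (Coeff.mk k (x 3) d) := fun a b c d x => by
    have e : x = Fin.append (Fin.append (Fin.append ![x 0] ![x 1]) ![x 2]) ![x 3] := by
      ext1 i; fin_cases i <;> rfl
    rw [e]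
    refine (PT.eval_pseudoJacobian ..).trans ?_
    rw [PT.eval_expandedProd]
    simp only [PT.eval_of]
    rfl
  -- Inside `σ₂₃` the elements stand in the order `a, c, b, d`; the transposition hands each of them
  -- its own argument `xᵢ`.
  have hs : ∀ x : Fin 4 → k[T;T⁻¹], x ∘ Equiv.swap (1 : Fin 4) 2 = ![x 0, x 2, x 1, x 3] :=
    fun x => by ext1 i; fin_cases i <;> rfl
  refine forall₄_congr fun a b c d => ?_
  have key : ∀ x : Fin 4 → k[T;T⁻¹], _ := fun x =>
    (⟨h₁ a b c d x, h₂ a b c d x, h₃ a c b d (x ∘ Equiv.swap (1 : Fin 4) 2),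
      h₄ a c b d (x ∘ Equiv.swap (1 : Fin 4) 2)⟩ : _ ∧ _ ∧ _ ∧ _)
  simp only [hs] at key
  -- Forwards, evaluate at `x`. Backwards, separation of points in `H^{⊗ 4}`, that is `n + 1`
  -- factors with `n = 3`.
  refine ⟨fun h x => ?_, fun h => PT.ext_eval (n := 3) fun x => ?_⟩
  · have e := congrArg (PT.eval x) h
    obtain ⟨k₁, k₂, k₃, k₄⟩ := key x
    rw [map_sub, map_neg, PT.eval_perm, map_add, hs, k₁, k₂, k₃, k₄] at e
    exact e
  · obtain ⟨k₁, k₂, k₃, k₄⟩ := key x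
    have e := h x
    refine Eq.trans ?_ (e.trans ?_)
    · rw [map_sub, map_neg, k₁, k₂]
    · rw [PT.eval_perm, map_add, hs, k₃, k₄]
      rfl

/-- The identity is additive in each of its four variables, and `Coeff C` is additively generated by
the elements `x ⊗_H a`. -/
theorem malcevPseudoIdentity_iff :
    MalcevPseudoIdentity k C ↔ ∀ a b c d : Coeff k C,
      -jacobian a b (c * d) - jacobian a b c * d =
        a * jacobian c b d + jacobian (a * c) b d := by
  rw [malcevPseudoIdentity_iff_mk]
  refine ⟨fun h a b c d => ?_, fun h a b c d x => h _ _ _ _⟩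
  rw [← sub_eq_zero]
  induction a using Coeff.induction_on with
  | add a a' ha ha' =>
    -- The target `0` is split as `0 + 0`, and each zero is replaced by the difference of the two
    -- sides for one summand; additivity then closes the goal. The other three variables are handled
    -- alike.
    rw [← add_zero (0 : Coeff k C)]
    nth_rewrite 1 [← ha]
    rw [← ha']
    simp only [jacobian, add_mul, mul_add, sub_mul, mul_sub]
    abel
  | mk x a =>
  induction b using Coeff.induction_on with
  | add b b' hb hb' =>
    rw [← add_zero (0 : Coeff k C)]
    nth_rewrite 1 [← hb]
    rw [← hb']
    simp only [jacobian, add_mul, mul_add, sub_mul, mul_sub]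
    abel
  | mk y b =>
  induction c using Coeff.induction_on with
  | add c c' hc hc' =>
    rw [← add_zero (0 : Coeff k C)]
    nth_rewrite 1 [← hc]
    rw [← hc']
    simp only [jacobian, add_mul, mul_add, sub_mul, mul_sub]
    abel
  | mk z c =>
  induction d using Coeff.induction_on with
  | add d d' hd hd' =>
    rw [← add_zero (0 : Coeff k C)]
    nth_rewrite 1 [← hd]
    rw [← hd']
    simp only [jacobian, add_mul, mul_add, sub_mul, mul_sub]
    abel
  | mk w d => exact sub_eq_zero.mpr (h a b c d ![x, y, z, w])

end Main

end

end Conformal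

theorem mainTheorem6 {k : Type*} [Field k] [CharZero k] {C : Type*} [AddCommGroup C] [Module k C]
    [Module k[X] C] [IsScalarTower k k[X] C] [ConformalAlgebra k C]
    (hC : Conformal.IsAnticommutativeConformal k C) :
    Conformal.IsMalcevConformal k C ↔ Conformal.MalcevPseudoIdentity k C := by
  refine (Conformal.isMalcev_iff hC fun a h => ?_).trans Conformal.malcevPseudoIdentity_iff.symm
  -- `Coeff C` is a vector space over a field of characteristic zero, hence has no 2-torsion.
  rw [← two_smul k a] at h
  exact (smul_eq_zero.mp h).resolve_left two_ne_zero
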